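/- **Conventions.** Graphs are simple and may be infinite and not locally finite. A ray is a one-way infinite path. Two rays are equivalent if no finite vertex set $S$ leaves tails of them in different components of $\Gamma\setminus S$; the equivalence classes are the ends of $\Gamma$, and $\Gamma$ is two-ended if it has exactly two ends. An end $\omega$ is dominated by a vertex $v$ if, for every finite vertex set $S\not\ni v$, the vertex $v$ lies in the component of $\Gamma\setminus S$ that contains a tail of a ray of $\omega$. A graph is quasi-transitive if its automorphism group has finitely many orbits on vertices, and rayless if it contains no ray. The double ray is the two-way infinite path. A connected graph $\Gamma$ is quasi-isometric to a connected graph $\Delta$ if there are $f:V(\Gamma)\to V(\Delta)$ and constants $\lambda\ge 1$, $\lambda'$ with $\frac1\lambda d_\Gamma(x,y)-\lambda\le d_\Delta(f(x),f(y))\le\lambda d_\Gamma(x,y)+\lambda$ for all $x,y\in V(\Gamma)$, and every vertex of $\Delta$ within distance $\lambda'$ of $f(V(\Gamma))$. **Tree-amalgamations.** Let $T$ be a tree with bipartition $\{V_1,V_2\}$, let $\Gamma_1,\Gamma_2$ be graphs with families $(S_k)_{k\in K}$, $(T_\ell)_{\ell\in L}$ of subsets (the adhesions) of $V(\Gamma_1)$,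 $V(\Gamma_2)$, and let $\phi_{k\ell}:S_k\to T_\ell$ be bijections (the identifying maps). Let $c:E(T)\to K\times L$ be such that at every vertex in $V_1$ the first coordinates of the labels of the incident edges take every value in $K$ exactly once, and at every vertex in $V_2$ the second coordinates take every value in $L$ exactly once. Take disjoint copies $\Gamma_i^v$ of $\Gamma_i$ for all $v\in V_i$, $i=1,2$, and, for every edge $st$ of $T$ with $s\in V_1$, $t\in V_2$, $c(st)=(k,\ell)$, identify each $x\in S_k$ in $\Gamma_1^s$ with $\phi_{k\ell}(x)$ in $\Gamma_2^t$. The resulting graph is a tree-amalgamation $\Gamma_1\ast_T\Gamma_2$. It is strongly thin if $T$ is the double ray (so $|K|=|L|=2$), all adhesions are finite, and $\Gamma_1,\Gamma_2$ are rayless. If $\Gamma_1=\Gamma_2=\bar\Gamma$ and $K=L$, the identifying maps are said to be all the identity if they are so after all adhesions have been identified, as induced subgraphs of $\bar\Gamma$, with one common graph: there are a graph $H$ and isomorphisms $\iota_k:H\to\bar\Gamma[S_k]$ $(k\in K)$ onto induced subgraphs such that $T_k=S_k$ for all $k$ and $\phi_{k\ell}=\iota_\ell\circ\iota_k^{-1}$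 for all $k,\ell$. **Theorem.** Let $\Gamma$ be a connected quasi-transitive graph without dominated ends. Then the following statements are equivalent: (i) $\Gamma$ is two-ended. (ii) $\Gamma$ is isomorphic to a strongly thin tree-amalgamation $\bar\Gamma\ast_T\bar\Gamma$ over the double ray $T$ such that (a) $\bar\Gamma$ is a connected rayless graph of finite diameter; (b) the identifying maps are all the identity; (c) the adhesions in $\bar\Gamma$ are finite, connected and pairwise disjoint. (iii) $\Gamma$ is quasi-isometric to the double ray. -/

import Mathlib

namespace TwoEndedGraph

universe u

section Ends

variable {V : Type u} (G : SimpleGraph V)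

/-- A ray: a one-way infinite path. -/
structure Ray where
  vert : ℕ → V
  injective : Function.Injective vert
  adj : ∀ n, G.Adj (vert n) (vert (n + 1))

/-- `u` and `v` are vertices of the same component of the graph obtained from `G` by deleting
the vertex set `S`. -/
def SameComponent (S : Set V) (u v : V) : Prop :=
  ∃ (hu : u ∈ Sᶜ) (hv : v ∈ Sᶜ), (G.induce Sᶜ).Reachable ⟨u, hu⟩ ⟨v, hv⟩

variable {G}

/-- No finite vertex set separates the tails of the two rays. -/
def Ray.Equivalent (R Q : Ray G) : Prop :=
  ∀ S : Finset V, ∃ N : ℕ, ∀ m ≥ N, ∀ n ≥ N, SameComponent G (S : Set V) (R.vert m) (Q.vert n)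

theorem SameComponent.symm {S : Set V} {u v : V} (h : SameComponent G S u v) :
    SameComponent G S v u := by
  obtain ⟨hu, hv, h⟩ := h
  exact ⟨hv, hu, h.symm⟩

theorem SameComponent.trans {S : Set V} {u v w : V} (h : SameComponent G S u v)
    (h' : SameComponent G S v w) : SameComponent G S u w := by
  obtain ⟨hu, _, h⟩ := h
  obtain ⟨_, hw, h'⟩ := h'
  exact ⟨hu, hw, h.trans h'⟩

/-- Every finite vertex set leaves some tail of a ray in a single component. -/
theorem Ray.equivalent_refl (R : Ray G) : R.Equivalent R := by
  intro S
  have hfin : {n : ℕ | R.vert n ∈ S}.Finite :=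
    S.finite_toSet.preimage R.injective.injOn
  obtain ⟨N, hN⟩ := hfin.bddAbove
  have havoid : ∀ n ≥ N + 1, R.vert n ∈ ((S : Set V)ᶜ) := by
    intro n hn hmem
    have : n ≤ N := hN hmem
    omega
  have key : ∀ n ≥ N + 1, SameComponent G (S : Set V) (R.vert (N + 1)) (R.vert n) := by
    intro n hn
    induction n, hn using Nat.le_induction with
    | base => exact ⟨havoid _ le_rfl, havoid _ le_rfl, SimpleGraph.Reachable.refl _⟩
    | succ n hn ih =>
      refine ih.trans ⟨havoid n hn, havoid (n + 1) (by omega), ?_⟩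
      apply SimpleGraph.Adj.reachable
      exact R.adj n
  exact ⟨N + 1, fun m hm n hn => (key m hm).symm.trans (key n hn)⟩

variable (G)

/-- Equivalence of rays. -/
def raySetoid : Setoid (Ray G) where
  r := Ray.Equivalent
  iseqv :=
    { refl := Ray.equivalent_refl
      symm := by
        intro R Q h S
        obtain ⟨N, hN⟩ := h S
        exact ⟨N, fun m hm n hn => (hN n hn m hm).symm⟩
      trans := by
        intro R Q P h h' S
        obtain ⟨N, hN⟩ := h S
        obtain ⟨M, hM⟩ := h' S
        exact ⟨max N M, fun m hm n hn =>
          (hN m (le_trans (le_max_left _ _) hm) (max N M) (le_max_left _ _)).trans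
            (hM (max N M) (le_max_right _ _) n (le_trans (le_max_right _ _) hn))⟩ }

/-- The ends of a graph: equivalence classes of rays. -/
def GraphEnd : Type u := Quotient (raySetoid G)

/-- The graph has exactly two ends. -/
def IsTwoEnded : Prop := Nat.card (GraphEnd G) = 2

/-- The graph contains no ray. -/
def IsRayless : Prop := IsEmpty (Ray G)

variable {G}

/-- The end `ω` is dominated by `v`: for every finite vertex set `S` not containing `v`, the
vertex `v` lies in the component of `G - S` in which `ω` lives, that is, which contains a tail of
some ray of `ω`. -/
def DominatedBy (ω : GraphEnd G) (v : V) : Prop :=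
  ∀ S : Finset V, v ∉ S → ∃ R : Ray G, Quotient.mk (raySetoid G) R = ω ∧
    ∃ N : ℕ, ∀ n ≥ N, SameComponent G (S : Set V) v (R.vert n)

variable (G)

/-- No end is dominated by a vertex. -/
def NoDominatedEnd : Prop := ∀ (ω : GraphEnd G) (v : V), ¬ DominatedBy ω v

/-- The automorphism group has only finitely many orbits on the vertex set. -/
def IsQuasiTransitive : Prop :=
  ∃ F : Finset V, ∀ v : V, ∃ x ∈ F, ∃ g : G ≃g G, g x = v

end Ends

/-- The double ray, on the vertex set `ℤ`. -/
def doubleRay : SimpleGraph ℤ where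
  Adj i j := j = i + 1 ∨ i = j + 1
  symm := ⟨fun _ _ h => h.symm⟩
  loopless := ⟨fun i h => by rcases h with h | h <;> omega⟩

/-- Quasi-isometry between the vertex sets of two (connected) graphs with their path metrics:
there is a quasi-dense quasi-isometric embedding of the first into the second. -/
def QuasiIsometric {V V' : Type*} (G : SimpleGraph V) (G' : SimpleGraph V') : Prop :=
  ∃ f : V → V',
    (∃ lam : ℝ, 1 ≤ lam ∧ ∀ x y : V,
      (1 / lam) * (G.dist x y : ℝ) - lam ≤ (G'.dist (f x) (f y) : ℝ) ∧
      (G'.dist (f x) (f y) : ℝ) ≤ lam * (G.dist x y : ℝ) + lam) ∧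
    (∃ lam' : ℝ, ∀ y : V', ∃ x : V, (G'.dist (f x) y : ℝ) ≤ lam')

/-- The data from which a tree-amalgamation of `Γ₁` and `Γ₂` over the connecting tree `T` is
built. `K` and `L` are the index sets of the adhesions of `Γ₁` and of `Γ₂`; by
`label_bijective₁` and `label_bijective₂`, every vertex of `T` in the class `side₁` of the
bipartition has `|K|` neighbours and every vertex in the other class has `|L|` neighbours. -/
structure TreeAmalgamation {U₁ U₂ W : Type*} (Γ₁ : SimpleGraph U₁) (Γ₂ : SimpleGraph U₂)
    (T : SimpleGraph W) (K L : Type*) where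
  isTree : T.IsTree
  /-- The first class of the bipartition of the tree; the second one is its complement. -/
  side₁ : Set W
  bipartition : ∀ s t, T.Adj s t → (s ∈ side₁ ↔ t ∉ side₁)
  /-- The labelling of the edges of the tree by pairs of indices. -/
  label : T.edgeSet → K × L
  label_bijective₁ : ∀ s ∈ side₁,
    Function.Bijective fun t : T.neighborSet s => (label ⟨s(s, (t : W)), t.2⟩).1
  label_bijective₂ : ∀ s ∉ side₁,
    Function.Bijective fun t : T.neighborSet s => (label ⟨s(s, (t : W)), t.2⟩).2
  /-- The adhesion sets in `Γ₁`. -/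
  adh₁ : K → Set U₁
  /-- The adhesion sets in `Γ₂`. -/
  adh₂ : L → Set U₂
  /-- The identifying maps. -/
  φ : ∀ k l, adh₁ k ≃ adh₂ l

namespace TreeAmalgamation

variable {U₁ U₂ W K L : Type*} {Γ₁ : SimpleGraph U₁} {Γ₂ : SimpleGraph U₂} {T : SimpleGraph W}

section Graph

variable (A : TreeAmalgamation Γ₁ Γ₂ T K L)

/-- The vertices of the disjoint union of one copy of `Γ₁` for every tree vertex in `side₁` and
one copy of `Γ₂` for every other tree vertex. -/
abbrev PreVertex : Type _ := (A.side₁ × U₁) ⊕ ((A.side₁)ᶜ : Set W) × U₂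

/-- Adjacency in the disjoint union of the copies. -/
def PreAdj : A.PreVertex → A.PreVertex → Prop
  | Sum.inl (s, x), Sum.inl (s', x') => s = s' ∧ Γ₁.Adj x x'
  | Sum.inr (t, y), Sum.inr (t', y') => t = t' ∧ Γ₂.Adj y y'
  | _, _ => False

/-- The identifications: for every tree edge `st` with label `(k, l)`, each vertex `x` of the
`k`-th adhesion set in the copy at `s` is identified with `φ k l x` in the copy at `t`. -/
def Glue : A.PreVertex → A.PreVertex → Prop
  | Sum.inl (s, x), Sum.inr (t, y) =>
      ∃ (h : T.Adj s t) (hx : x ∈ A.adh₁ (A.label ⟨s((s : W), (t : W)), h⟩).1),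
        (A.φ _ (A.label ⟨s((s : W), (t : W)), h⟩).2 ⟨x, hx⟩ : U₂) = y
  | _, _ => False

/-- The vertices of the tree-amalgamation: the quotient by the equivalence relation generated by
the identifications. -/
def Vertex : Type _ := Quot A.Glue

theorem PreAdj.symm {p q : A.PreVertex} (h : A.PreAdj p q) : A.PreAdj q p := by
  rcases p with ⟨s, x⟩ | ⟨t, y⟩ <;> rcases q with ⟨s', x'⟩ | ⟨t', y'⟩
  · exact ⟨h.1.symm, h.2.symm⟩
  · exact h.elim
  · exact h.elim
  · exact ⟨h.1.symm, h.2.symm⟩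

/-- The tree-amalgamation `Γ₁ ∗_T Γ₂`. -/
def graph : SimpleGraph A.Vertex where
  Adj a b := a ≠ b ∧ ∃ p q : A.PreVertex, A.PreAdj p q ∧ Quot.mk A.Glue p = a ∧
    Quot.mk A.Glue q = b
  symm := ⟨fun _ _ ⟨hne, p, q, h, hp, hq⟩ => ⟨hne.symm, q, p, PreAdj.symm A h, hq, hp⟩⟩
  loopless := ⟨fun _ h => h.1 rfl⟩

/-- Thin: all adhesions are finite and the connecting tree is the double ray. -/
def IsThin : Prop :=
  Nonempty (T ≃g doubleRay) ∧ (∀ k, (A.adh₁ k).Finite) ∧ ∀ l, (A.adh₂ l).Finite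

end Graph

/-- Strongly thin: thin, and both factors are rayless. -/
def IsStronglyThin {U₁ U₂ : Type u} {Γ₁ : SimpleGraph U₁} {Γ₂ : SimpleGraph U₂}
    (A : TreeAmalgamation Γ₁ Γ₂ T K L) : Prop :=
  A.IsThin ∧ IsRayless Γ₁ ∧ IsRayless Γ₂

/-- For two equal factors `Γ` with the same family of adhesions: the identifying maps are all the
identity. Distinct adhesions are distinct subsets of `Γ`, so this is understood after all of them
have been identified, as induced subgraphs of `Γ`, with one and the same graph `H`: the `k`-th
adhesion is the image of the embedding `ι k` of `H`, and every identifying map sends the point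
`n` of `H` to the point `n` of `H`. In particular `φ k k` is literally the identity map. -/
def IdentifyingMapsAreIdentity {U : Type u} {Γ : SimpleGraph U}
    (A : TreeAmalgamation Γ Γ T K K) : Prop :=
  ∃ (N : Type u) (H : SimpleGraph N) (ι : K → (H ↪g Γ)),
    (∀ k, Set.range (ι k) = A.adh₁ k) ∧ (∀ l, Set.range (ι l) = A.adh₂ l) ∧
    ∀ (k l : K) (x : A.adh₁ k) (n : N), (x : U) = ι k n → (A.φ k l x : U) = ι l n

end TreeAmalgamation

/-- `G` splits as a strongly thin tree-amalgamation `Γ ∗_T Γ` over the double ray, where `Γ` is a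
connected rayless graph of finite diameter, the identifying maps are all the identity, and the
(two) adhesions in `Γ` are finite, connected and disjoint. -/
def SplitsAsStronglyThin {V : Type u} (G : SimpleGraph V) : Prop :=
  ∃ (U : Type u) (Γ : SimpleGraph U)
    (A : TreeAmalgamation Γ Γ doubleRay (Fin 2) (Fin 2)),
    Nonempty (G ≃g A.graph) ∧ A.IsStronglyThin ∧
    (Γ.Connected ∧ IsRayless Γ ∧ Γ.ediam ≠ ⊤) ∧
    A.IdentifyingMapsAreIdentity ∧
    (∀ k, (A.adh₁ k).Finite ∧ (Γ.induce (A.adh₁ k)).Connected) ∧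
    Pairwise fun k l => Disjoint (A.adh₁ k) (A.adh₁ l)

end TwoEndedGraph

/-! The proof is the cycle (i) ⇒ (ii) ⇒ (iii) ⇒ (i). Absence of dominated ends replaces local
finiteness: any ball, even an infinite one, can be separated from any end by a finite set
(`exists_live_forall_lt_dist`), so every ray leaves every ball.

(i) ⇒ (ii). Separate the ends of two rays `R` and `Q` by a finite connected set `S`. By
quasi-transitivity copies of `S` occur near vertices far out on either ray, hence on both sides of
`S`. Combining two such automorphisms gives one, `g`, that fixes both ends and pushes `S` into the
component `C` of `R` (`exists_isTranslation`). Nestedness of separators yields `g (S ∪ C) ⊆ C`. The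
piece `(S ∪ C) \ g C` and its translates under powers of `g` cover all vertices and edges, and
distinct translates meet only if consecutive, in a translate of `S`; this is a chain of copies of
the piece glued along `S` and `g S` (`IsShift.nonempty_iso_chain`). The piece is connected because
`S` and `g S` are, rayless because both ends live outside it, and of finite diameter because near
each of its vertices there is a copy of `S`, which must separate the two ends
(`IsTranslation.ediam_piece_ne_top`).

(ii) ⇒ (iii). Disjoint adhesions put each vertex in at most two copies, with consecutive indices.
Sending it to one of these indices is a quasi-isometry, since each copy has bounded diameter and
consecutive copies overlap.

(iii) ⇒ (i). Along a ray the coordinate of a quasi-isometry to the line tends to `+∞` or to `-∞`.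
Two rays of the same sign are joined by short paths far out, rays of opposite signs are separated by
a finite set, and both signs occur. -/

namespace TwoEndedGraph

universe u

/-! ### Components left by finite sets, and the ends living in them -/

section Components

variable {V : Type u} {G : SimpleGraph V}

theorem SameComponent.refl {S : Set V} {u : V} (hu : u ∉ S) : SameComponent G S u u :=
  ⟨hu, hu, SimpleGraph.Reachable.refl _⟩

theorem SameComponent.of_adj {S : Set V} {u v : V} (hu : u ∉ S) (hv : v ∉ S) (h : G.Adj u v) :
    SameComponent G S u v :=
  ⟨hu, hv, SimpleGraph.Adj.reachable (by simpa using h)⟩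

theorem SameComponent.left {S : Set V} {u v : V} (h : SameComponent G S u v) : u ∉ S := h.1

theorem SameComponent.right {S : Set V} {u v : V} (h : SameComponent G S u v) : v ∉ S := h.2.1

theorem exists_walk_of_induce {T : Set V} {a b : T} (p : (G.induce T).Walk a b) :
    ∃ q : G.Walk (a : V) b, ∀ x ∈ q.support, x ∈ T := by
  induction p with
  | nil => exact ⟨.nil, by simp⟩
  | @cons a b c h p ih =>
    obtain ⟨q, hq⟩ := ih
    have h' : G.Adj (a : V) b := h
    refine ⟨.cons h' q, fun x hx => ?_⟩
    rw [SimpleGraph.Walk.support_cons, List.mem_cons] at hx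
    rcases hx with rfl | hx
    exacts [a.2, hq x hx]

theorem SameComponent.exists_walk {S : Set V} {u v : V} (h : SameComponent G S u v) :
    ∃ p : G.Walk u v, ∀ x ∈ p.support, x ∉ S := by
  obtain ⟨hu, hv, ⟨p⟩⟩ := h
  exact exists_walk_of_induce p

theorem SameComponent.of_walk {S : Set V} {u v : V} (p : G.Walk u v)
    (hp : ∀ x ∈ p.support, x ∉ S) : SameComponent G S u v :=
  ⟨hp u p.start_mem_support, hp v p.end_mem_support, ⟨p.induce Sᶜ hp⟩⟩

theorem SameComponent.mono {S S' : Set V} (hS : S ⊆ S') {u v : V}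
    (h : SameComponent G S' u v) : SameComponent G S u v := by
  obtain ⟨p, hp⟩ := h.exists_walk
  exact .of_walk p fun x hx hxS => hp x hx (hS hxS)

/-- A walk starting in a set `A` that can only be left through `S` stays in `A` as long as it
avoids `S`. -/
theorem mem_of_walk_of_closed {S A : Set V} (hA : ∀ a ∈ A, ∀ b, G.Adj a b → b ∉ S → b ∈ A)
    {u v : V} (p : G.Walk u v) (hp : ∀ x ∈ p.support, x ∉ S) (hu : u ∈ A) :
    ∀ x ∈ p.support, x ∈ A := by
  induction p with
  | nil => simpa using hu
  | cons h p ih =>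
    intro x hx
    rw [SimpleGraph.Walk.support_cons, List.mem_cons] at hx
    rcases hx with rfl | hx
    · exact hu
    · refine ih (fun y hy => hp y (by simp [hy])) (hA _ hu _ h (hp _ (by simp))) x hx

theorem SameComponent.of_connected {S T : Set V} (hT : (G.induce T).Preconnected)
    (hST : Disjoint S T) {u v : V} (hu : u ∈ T) (hv : v ∈ T) : SameComponent G S u v := by
  obtain ⟨p⟩ := hT ⟨u, hu⟩ ⟨v, hv⟩
  obtain ⟨q, hq⟩ := exists_walk_of_induce p
  exact .of_walk q fun x hx => Set.disjoint_right.1 hST (hq x hx)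

/-- In a connected graph every component of `G - S` is adjacent to `S`. -/
theorem exists_adj_of_connected (hG : G.Connected) {S : Set V} (hS : S.Nonempty) {w : V}
    (hw : w ∉ S) : ∃ u, ∃ s ∈ S, G.Adj u s ∧ SameComponent G S w u := by
  by_contra hcon
  push Not at hcon
  obtain ⟨s, hs⟩ := hS
  obtain ⟨p⟩ := hG w s
  have := mem_of_walk_of_closed (S := ∅) (A := {x | SameComponent G S w x}) (fun a ha b hab _ => ?_)
    p (by simp) (.refl hw) s p.end_mem_support
  · exact this.right hs
  · by_cases hb : b ∈ S
    · exact absurd ha (hcon a b hb hab)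
    · exact SameComponent.trans ha (.of_adj (SameComponent.right ha) hb hab)

variable (G) in
/-- The vertex set of the component of `G - S` that contains a tail of the ray `R`. -/
def live (S : Set V) (R : Ray G) : Set V :=
  {v | ∃ N : ℕ, ∀ n ≥ N, SameComponent G S v (R.vert n)}

theorem live_of_sameComponent {S : Set V} {R : Ray G} {u v : V} (hu : u ∈ live G S R)
    (h : SameComponent G S u v) : v ∈ live G S R := by
  obtain ⟨N, hN⟩ := hu
  exact ⟨N, fun n hn => h.symm.trans (hN n hn)⟩

theorem notMem_of_mem_live {S : Set V} {R : Ray G} {u : V} (hu : u ∈ live G S R) : u ∉ S := by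
  obtain ⟨N, hN⟩ := hu
  exact (hN N le_rfl).left

theorem disjoint_live (S : Set V) (R : Ray G) : Disjoint S (live G S R) :=
  Set.disjoint_right.2 fun _ h => notMem_of_mem_live h

theorem live_closed {S : Set V} {R : Ray G} : ∀ a ∈ live G S R, ∀ b, G.Adj a b → b ∉ S →
    b ∈ live G S R := fun _ ha _ hab hb =>
  live_of_sameComponent ha (.of_adj (notMem_of_mem_live ha) hb hab)

theorem live_anti {S S' : Set V} (hS : S ⊆ S') (R : Ray G) : live G S' R ⊆ live G S R :=
  fun _ ⟨N, hN⟩ => ⟨N, fun n hn => (hN n hn).mono hS⟩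

theorem eventually_mem_live {S : Set V} (hS : S.Finite) (R : Ray G) :
    ∃ N, ∀ n ≥ N, R.vert n ∈ live G S R := by
  obtain ⟨N, hN⟩ := R.equivalent_refl hS.toFinset
  simp only [Set.Finite.coe_toFinset] at hN
  exact ⟨N, fun n hn => ⟨N, fun m hm => hN n hn m hm⟩⟩

theorem live_nonempty {S : Set V} (hS : S.Finite) (R : Ray G) : (live G S R).Nonempty := by
  obtain ⟨N, hN⟩ := eventually_mem_live hS R
  exact ⟨_, hN N le_rfl⟩

theorem Ray.Equivalent.symm {R Q : Ray G} (h : R.Equivalent Q) : Q.Equivalent R :=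
  (raySetoid G).symm h

theorem Ray.Equivalent.trans {R Q P : Ray G} (h : R.Equivalent Q) (h' : Q.Equivalent P) :
    R.Equivalent P :=
  (raySetoid G).trans h h'

theorem live_subset_of_equivalent {S : Set V} (hS : S.Finite) {R Q : Ray G}
    (h : R.Equivalent Q) : live G S R ⊆ live G S Q := by
  rintro v ⟨N, hN⟩
  obtain ⟨M, hM⟩ := h hS.toFinset
  simp only [Set.Finite.coe_toFinset] at hM
  exact ⟨M, fun n hn => (hN _ (le_max_left N M)).trans (hM _ (le_max_right N M) n hn)⟩

theorem live_congr {S : Set V} (hS : S.Finite) {R Q : Ray G}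
    (h : R.Equivalent Q) : live G S R = live G S Q :=
  (live_subset_of_equivalent hS h).antisymm (live_subset_of_equivalent hS h.symm)

/-- Inequivalent rays are separated by some finite set. -/
theorem exists_disjoint_live {R Q : Ray G} (h : ¬ R.Equivalent Q) :
    ∃ S : Finset V, Disjoint (live G (S : Set V) R) (live G (S : Set V) Q) := by
  unfold Ray.Equivalent at h
  push Not at h
  obtain ⟨S, hS⟩ := h
  refine ⟨S, Set.disjoint_left.2 ?_⟩
  rintro v ⟨N, hN⟩ ⟨M, hM⟩
  obtain ⟨m, hm, n, hn, hmn⟩ := hS (max N M)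
  exact hmn ((hN m ((le_max_left _ _).trans hm)).symm.trans (hM n ((le_max_right _ _).trans hn)))

theorem not_equivalent_of_disjoint {S : Set V} (hS : S.Finite) {R Q : Ray G}
    (h : Disjoint (live G S R) (live G S Q)) : ¬ R.Equivalent Q := by
  intro he
  rw [live_congr hS he, disjoint_self] at h
  exact (live_nonempty hS Q).ne_empty h

theorem exists_notMem_live (hdom : NoDominatedEnd G) (R : Ray G) (v : V) :
    ∃ S : Finset V, v ∉ S ∧ v ∉ live G (S : Set V) R := by
  by_contra hcon
  push Not at hcon
  exact hdom (Quotient.mk _ R) v fun S hS => ⟨R, rfl, hcon S hS⟩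

/-- If no end is dominated, then every ball can be separated from every end by a finite set. -/
theorem exists_live_forall_lt_dist (hG : G.Connected) (hdom : NoDominatedEnd G) (R : Ray G) (r : ℕ)
    (v : V) : ∃ S : Finset V, ∀ u ∈ live G (S : Set V) R, r < G.dist v u := by
  classical
  induction r generalizing v with
  | zero =>
    refine ⟨{v}, fun u hu => hG.pos_dist_of_ne ?_⟩
    rintro rfl
    exact notMem_of_mem_live hu (by simp)
  | succ r ih =>
    obtain ⟨S₀, hv, hvS⟩ := exists_notMem_live hdom R v
    choose f hf using ih
    refine ⟨S₀ ∪ S₀.biUnion f, fun u hu => ?_⟩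
    by_contra hlt
    push Not at hlt
    have hu₀ : u ∈ live G (S₀ : Set V) R := live_anti (by simp) R hu
    obtain ⟨p, hp⟩ := hG.exists_walk_length_eq_dist v u
    have : ∃ s ∈ p.support, s ∈ S₀ := by
      by_contra hcon
      push Not at hcon
      exact hvS (live_of_sameComponent hu₀ (SameComponent.of_walk p (by simpa using hcon)).symm)
    obtain ⟨s, hsp, hs⟩ := this
    have hsv : s ≠ v := by rintro rfl; exact hv hs
    have h1 : r < G.dist s u := by
      refine hf s u (live_anti ?_ R hu)
      intro x hx
      simp only [Finset.coe_union, Finset.coe_biUnion, Set.mem_union, Set.mem_iUnion]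
      exact Or.inr ⟨s, hs, hx⟩
    have h2 := congrArg SimpleGraph.Walk.length (p.take_spec hsp)
    rw [SimpleGraph.Walk.length_append] at h2
    have h3 := SimpleGraph.dist_le (p.dropUntil s hsp)
    have h4 : 0 < (p.takeUntil s hsp).length := by
      rw [Nat.pos_iff_ne_zero]
      intro h0
      exact hsv (SimpleGraph.Walk.eq_of_length_eq_zero h0).symm
    omega

theorem eventually_lt_dist (hG : G.Connected) (hdom : NoDominatedEnd G) (R : Ray G) (r : ℕ)
    (v : V) : ∃ N, ∀ n ≥ N, r < G.dist v (R.vert n) := by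
  obtain ⟨S, hS⟩ := exists_live_forall_lt_dist hG hdom R r v
  obtain ⟨N, hN⟩ := eventually_mem_live S.finite_toSet R
  exact ⟨N, fun n hn => hS _ (hN n hn)⟩

theorem isTwoEnded_iff : IsTwoEnded G ↔
    ∃ R Q : Ray G, ¬ R.Equivalent Q ∧ ∀ P : Ray G, P.Equivalent R ∨ P.Equivalent Q := by
  rw [IsTwoEnded, Nat.card_eq_two_iff]
  constructor
  · rintro ⟨x, y, hxy, huniv⟩
    obtain ⟨R, rfl⟩ := Quotient.exists_rep x
    obtain ⟨Q, rfl⟩ := Quotient.exists_rep y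
    refine ⟨R, Q, fun h => hxy (Quotient.sound h), fun P => ?_⟩
    have : ∀ z : GraphEnd G, z = Quotient.mk (raySetoid G) R ∨ z = Quotient.mk (raySetoid G) Q :=
      Set.eq_univ_iff_forall.1 huniv
    specialize this (Quotient.mk (raySetoid G) P)
    exact this.imp Quotient.exact Quotient.exact
  · rintro ⟨R, Q, hRQ, h⟩
    refine ⟨Quotient.mk _ R, Quotient.mk _ Q, fun he => hRQ (Quotient.exact he), ?_⟩
    rw [Set.eq_univ_iff_forall]
    intro x
    obtain ⟨P, rfl⟩ := Quotient.exists_rep x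
    exact (h P).imp (fun h => Quotient.sound h) (fun h => Quotient.sound h)

end Components

/-! ### The metric of the double ray -/

theorem exists_walk_doubleRay_add (i : ℤ) (n : ℕ) :
    ∃ p : doubleRay.Walk i (i + n), p.length = n := by
  induction n with
  | zero => exact ⟨SimpleGraph.Walk.nil.copy rfl (by simp), by simp⟩
  | succ n ih =>
    obtain ⟨p, hp⟩ := ih
    refine ⟨p.concat (show doubleRay.Adj _ _ from Or.inl (by push_cast; ring)), ?_⟩
    simp [hp]

theorem doubleRay_connected : doubleRay.Connected := by
  have key : ∀ i j : ℤ, i ≤ j → doubleRay.Reachable i j := by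
    intro i j hij
    obtain ⟨n, rfl⟩ := Int.le.dest hij
    exact ⟨(exists_walk_doubleRay_add i n).choose⟩
  refine ⟨fun i j => ?_⟩
  rcases le_total i j with h | h
  exacts [key i j h, (key j i h).symm]

theorem abs_sub_le_walk_length {i j : ℤ} (p : doubleRay.Walk i j) : |i - j| ≤ p.length := by
  induction p with
  | nil => simp
  | @cons a b c h p ih =>
    have h1 : |a - b| ≤ 1 := by rcases h with rfl | rfl <;> simp
    have h2 := abs_sub_le a b c
    rw [SimpleGraph.Walk.length_cons]
    push_cast
    omega

theorem doubleRay_dist (i j : ℤ) : (doubleRay.dist i j : ℤ) = |i - j| := by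
  have key : ∀ i j : ℤ, i ≤ j → (doubleRay.dist i j : ℤ) ≤ |i - j| := by
    intro i j hij
    obtain ⟨n, rfl⟩ := Int.le.dest hij
    obtain ⟨p, hp⟩ := exists_walk_doubleRay_add i n
    have := SimpleGraph.dist_le p
    simp only [sub_add_cancel_left, abs_neg, Nat.abs_cast, Nat.cast_le]
    omega
  apply le_antisymm
  · rcases le_total i j with h | h
    · exact key i j h
    · rw [SimpleGraph.dist_comm, abs_sub_comm]
      exact key j i h
  · obtain ⟨p, hp⟩ := doubleRay_connected.exists_walk_length_eq_dist i j
    rw [← hp]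
    exact abs_sub_le_walk_length p

/-! ### Graphs quasi-isometric to the double ray are two-ended -/

section CoarseLine

variable {V : Type u} {G : SimpleGraph V}

/-- The map `f` is a quasi-isometry to the double ray, with all constants equal to `K`. -/
structure IsCoarseLine (G : SimpleGraph V) (f : V → ℤ) (K : ℕ) : Prop where
  upper : ∀ x y, |f x - f y| ≤ K * G.dist x y + K
  lower : ∀ x y, (G.dist x y : ℤ) ≤ K * |f x - f y| + K
  dense : ∀ n : ℤ, ∃ x, |f x - n| ≤ K

theorem QuasiIsometric.exists_isCoarseLine (h : QuasiIsometric G doubleRay) :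
    ∃ f K, IsCoarseLine G f K := by
  obtain ⟨f, ⟨lam, hlam, hf⟩, lam', hlam'⟩ := h
  have hd : ∀ i j : ℤ, (doubleRay.dist i j : ℝ) = (|i - j| : ℤ) := fun i j => by
    rw [← doubleRay_dist]; simp
  -- Clearing the factor `1 / lam` in the lower bound turns the additive error into `lam * lam`,
  -- which also dominates `lam` as `1 ≤ lam`.
  obtain ⟨K, hK⟩ := exists_nat_ge (max (lam * lam) lam')
  have hK1 : lam * lam ≤ K := (le_max_left _ _).trans hK
  have hK2 : lam' ≤ K := (le_max_right _ _).trans hK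
  have hK3 : lam ≤ K := by nlinarith
  refine ⟨f, K, fun x y => ?_, fun x y => ?_, fun n => ?_⟩
  · have h1 := (hf x y).2
    rw [hd] at h1
    have h2 : lam * (G.dist x y : ℝ) ≤ K * G.dist x y := by gcongr
    have h3 : ((|f x - f y| : ℤ) : ℝ) ≤ ((K * G.dist x y + K : ℤ) : ℝ) := by
      push_cast at h1 ⊢; linarith
    exact_mod_cast h3
  · have h1 := (hf x y).1
    rw [hd] at h1
    have h0 : (0 : ℝ) < lam := by linarith
    have habs : (0 : ℝ) ≤ ((|f x - f y| : ℤ) : ℝ) := by exact_mod_cast abs_nonneg _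
    have h2 : (G.dist x y : ℝ) ≤ lam * ((|f x - f y| : ℤ) : ℝ) + lam * lam := by
      have := mul_le_mul_of_nonneg_left h1 h0.le
      have e : lam * (1 / lam * (G.dist x y : ℝ) - lam) = G.dist x y - lam * lam := by
        field_simp
      linarith
    have h2' : lam * ((|f x - f y| : ℤ) : ℝ) ≤ K * ((|f x - f y| : ℤ) : ℝ) := by gcongr
    have h3 : ((G.dist x y : ℤ) : ℝ) ≤ ((K * |f x - f y| + K : ℤ) : ℝ) := by
      push_cast at h2 h2' ⊢; linarith
    exact_mod_cast h3
  · obtain ⟨x, hx⟩ := hlam' n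
    rw [hd] at hx
    refine ⟨x, ?_⟩
    have : ((|f x - n| : ℤ) : ℝ) ≤ ((K : ℤ) : ℝ) := by
      push_cast at hx ⊢; linarith
    exact_mod_cast this

namespace IsCoarseLine

variable {f : V → ℤ} {K : ℕ}

theorem neg (h : IsCoarseLine G f K) : IsCoarseLine G (fun x => -f x) K where
  upper x y := by
    have := h.upper x y
    rwa [neg_sub_neg, abs_sub_comm]
  lower x y := by
    have := h.lower x y
    rwa [neg_sub_neg, abs_sub_comm (f y)]
  dense n := by
    obtain ⟨x, hx⟩ := h.dense (-n)
    refine ⟨x, ?_⟩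
    rwa [show -f x - n = -n - f x by ring, abs_sub_comm]

theorem abs_sub_le_of_adj (h : IsCoarseLine G f K) {x y : V} (hxy : G.Adj x y) :
    |f x - f y| ≤ 2 * K := by
  have := h.upper x y
  rw [SimpleGraph.dist_eq_one_iff_adj.2 hxy] at this
  push_cast at this
  linarith

/-- Along a walk that crosses zero, `f` takes a value close to zero. -/
theorem exists_abs_le_of_walk (h : IsCoarseLine G f K) {u v : V} (p : G.Walk u v) (hu : 0 ≤ f u)
    (hv : f v ≤ 0) : ∃ x ∈ p.support, |f x| ≤ 2 * K := by
  induction p with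
  | nil => exact ⟨_, List.mem_singleton_self _, by rw [le_antisymm hv hu]; simp⟩
  | @cons a b c hab p ih =>
    rcases le_total 0 (f b) with hb | hb
    · obtain ⟨x, hx, hfx⟩ := ih hb hv
      exact ⟨x, by simp [hx], hfx⟩
    · refine ⟨a, by simp, ?_⟩
      have := h.abs_sub_le_of_adj hab
      rw [abs_le] at this ⊢
      constructor <;> linarith [this.1, this.2]

/-- Vertices with `|f u| ≤ M` lie in a ball around any fixed `v`, by the lower bound, and balls can
be cut off from ends. -/
theorem exists_live_forall_lt_abs (h : IsCoarseLine G f K) (hG : G.Connected)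
    (hdom : NoDominatedEnd G) (R : Ray G) (M : ℕ) :
    ∃ S : Finset V, ∀ u ∈ live G (S : Set V) R, M < |f u| := by
  obtain ⟨v⟩ := hG.nonempty
  obtain ⟨S, hS⟩ := exists_live_forall_lt_dist hG hdom R (K * (|f v| + M) + K).toNat v
  refine ⟨S, fun u hu => ?_⟩
  have h1 := hS u hu
  have h2 := h.lower v u
  rw [Int.toNat_lt (by positivity)] at h1
  by_contra hcon
  push Not at hcon
  have h3 : |f v - f u| ≤ |f v| + M := (abs_sub _ _).trans (by linarith)
  have : (K : ℤ) * |f v - f u| ≤ K * (|f v| + M) := by gcongr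
  linarith

/-- The ray `R` tends to the positive end of the line. -/
def Positive (f : V → ℤ) (R : Ray G) : Prop := ∀ M : ℕ, ∃ N, ∀ n ≥ N, (M : ℤ) < f (R.vert n)

/-- Once `|f|` stays above `2 * K`, the sign of `f` along the ray is frozen, since one edge changes
`f` by at most `2 * K`. -/
theorem positive_or (h : IsCoarseLine G f K) (hG : G.Connected) (hdom : NoDominatedEnd G)
    (R : Ray G) : Positive f R ∨ Positive (fun x => -f x) R := by
  have key : ∀ M : ℕ, ∃ N, ∀ n ≥ N, M < |f (R.vert n)| := by
    intro M
    obtain ⟨S, hS⟩ := h.exists_live_forall_lt_abs hG hdom R M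
    obtain ⟨N, hN⟩ := eventually_mem_live S.finite_toSet R
    exact ⟨N, fun n hn => hS _ (hN n hn)⟩
  obtain ⟨N₀, hN₀⟩ := key (2 * K)
  push_cast at hN₀
  have hstep : ∀ n, |f (R.vert n) - f (R.vert (n + 1))| ≤ 2 * K := fun n =>
    h.abs_sub_le_of_adj (R.adj n)
  rcases le_total 0 (f (R.vert N₀)) with h0 | h0
  · left
    have hpos : ∀ n ≥ N₀, 0 ≤ f (R.vert n) := by
      intro n hn
      induction n, hn using Nat.le_induction with
      | base => exact h0
      | succ n hn ih =>
        have h1 := hN₀ n hn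
        have h2 := hstep n
        rw [abs_of_nonneg ih] at h1
        rw [abs_le] at h2
        linarith [h2.2]
    intro M
    obtain ⟨N, hN⟩ := key M
    refine ⟨max N N₀, fun n hn => ?_⟩
    have := hN n ((le_max_left _ _).trans hn)
    rwa [abs_of_nonneg (hpos n ((le_max_right _ _).trans hn))] at this
  · right
    have hneg : ∀ n ≥ N₀, f (R.vert n) ≤ 0 := by
      intro n hn
      induction n, hn using Nat.le_induction with
      | base => exact h0
      | succ n hn ih =>
        have h1 := hN₀ n hn
        have h2 := hstep n
        rw [abs_of_nonpos ih] at h1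
        rw [abs_le] at h2
        linarith [h2.1]
    intro M
    obtain ⟨N, hN⟩ := key M
    refine ⟨max N N₀, fun n hn => ?_⟩
    have := hN n ((le_max_left _ _).trans hn)
    rwa [abs_of_nonpos (hneg n ((le_max_right _ _).trans hn))] at this

/-- A walk between the tails must pass a vertex with `|f| ≤ 2 * K`, but a suitable finite set keeps
all such vertices out of the component of `R`. -/
theorem not_equivalent (h : IsCoarseLine G f K) (hG : G.Connected) (hdom : NoDominatedEnd G)
    {R Q : Ray G} (hR : Positive f R) (hQ : Positive (fun x => -f x) Q) : ¬ R.Equivalent Q := by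
  intro hRQ
  obtain ⟨S, hS⟩ := h.exists_live_forall_lt_abs hG hdom R (2 * K)
  obtain ⟨N, hN⟩ := hRQ S
  obtain ⟨N₁, hN₁⟩ := hR 0
  obtain ⟨N₂, hN₂⟩ := hQ 0
  obtain ⟨N₃, hN₃⟩ := eventually_mem_live S.finite_toSet R
  have hlive := hN₃ (max N₃ (max N N₁)) (le_max_left _ _)
  obtain ⟨p, hp⟩ := (hN (max N₃ (max N N₁)) (by omega) (max N N₂) (by omega)).exists_walk
  have hm := hN₁ (max N₃ (max N N₁)) (by omega)
  have hn := hN₂ (max N N₂) (by omega)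
  push_cast at hm hn
  obtain ⟨x, hx, hfx⟩ := h.exists_abs_le_of_walk p hm.le (by linarith)
  have := hS x (mem_of_walk_of_closed live_closed p hp hlive x hx)
  push_cast at this
  omega

/-- Along a geodesic of length at most `L`, the value of `f` drops by at most `K * L + K`, which is
too little to reach `S`. -/
theorem sameComponent_of_dist_le (h : IsCoarseLine G f K) (hG : G.Connected) {S : Set V} {M L : ℕ}
    (hM : ∀ s ∈ S, f s ≤ M) {u v : V} (hu : (M : ℤ) + K * L + K < f u) (huv : G.dist u v ≤ L) :
    SameComponent G S u v := by
  classical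
  obtain ⟨p, hp⟩ := hG.exists_walk_length_eq_dist u v
  refine .of_walk p fun x hx hxS => ?_
  have h1 := h.upper u x
  have h2 : G.dist u x ≤ L :=
    (SimpleGraph.dist_le (p.takeUntil x hx)).trans
      ((p.length_takeUntil_le_length hx).trans (hp.trans_le huv))
  have h3 : (K : ℤ) * G.dist u x ≤ K * L := by gcongr
  have h4 := hM x hxS
  have h5 := (abs_le.1 h1).2
  linarith

theorem equivalent (h : IsCoarseLine G f K) (hG : G.Connected)
    {R Q : Ray G} (hR : Positive f R) (hQ : Positive f Q) : R.Equivalent Q := by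
  intro S
  obtain ⟨M, hM⟩ : ∃ M : ℕ, ∀ s ∈ (S : Set V), f s ≤ M := by
    obtain ⟨B, hB⟩ := (S.finite_toSet.image f).bddAbove
    exact ⟨B.toNat, fun s hs => (hB ⟨s, hs, rfl⟩).trans (Int.self_le_toNat B)⟩
  -- The chosen `y n` satisfies `|f (y n) - n| ≤ K`, so consecutive ones have values at most `2 * K
  -- + 1` apart and are at distance at most `L`. Above the bound `B` set below, jumps of length `L`
  -- between them avoid `S`.
  set L := K * (2 * K + 1) + K with hL
  have hdist : ∀ u v, |f u - f v| ≤ 2 * K + 1 → G.dist u v ≤ L := by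
    intro u v huv
    have h1 := h.lower u v
    have : (K : ℤ) * |f u - f v| ≤ K * (2 * K + 1) := by gcongr
    zify
    rw [hL]
    push_cast
    linarith
  choose y hy using h.dense
  have hy' := fun n => abs_le.1 (hy n)
  set B : ℤ := M + K * L + K + K with hB
  have hchain : ∀ a b : ℤ, a ≤ b → B < a → SameComponent G S (y a) (y b) := by
    intro a b hab ha
    induction b, hab using Int.leInduction with
    | base =>
      refine h.sameComponent_of_dist_le (L := L) hG hM ?_ (by simp)
      linarith [(hy' a).1]
    | succ b hab ih =>
      refine ih.trans (h.sameComponent_of_dist_le (L := L) hG hM ?_ (hdist _ _ ?_))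
      · linarith [(hy' b).1]
      · rw [abs_le]
        constructor <;> linarith [(hy' b).1, (hy' b).2, (hy' (b + 1)).1, (hy' (b + 1)).2]
  have hnear : ∀ u, B < f u → SameComponent G S u (y (f u)) := by
    intro u hu
    refine h.sameComponent_of_dist_le (L := L) hG hM (by linarith) (hdist _ _ ?_)
    rw [abs_sub_comm]
    linarith [hy (f u)]
  have hall : ∀ u v, B < f u → B < f v → SameComponent G S u v := by
    intro u v hu hv
    refine (hnear u hu).trans (SameComponent.trans ?_ (hnear v hv).symm)
    rcases le_total (f u) (f v) with huv | huv
    exacts [hchain _ _ huv hu, (hchain _ _ huv hv).symm]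
  obtain ⟨N, hN⟩ := hR B.toNat
  obtain ⟨N', hN'⟩ := hQ B.toNat
  have hBt := Int.self_le_toNat B
  exact ⟨max N N', fun m hm n hn => hall _ _
    (hBt.trans_lt (hN m ((le_max_left _ _).trans hm)))
    (hBt.trans_lt (hN' n ((le_max_right _ _).trans hn)))⟩

end IsCoarseLine

/-- A sequence of vertices in which consecutive members are equal or adjacent, and which visits
every vertex finitely often, has a subsequence that is a ray. -/
theorem exists_ray_of_sequence (w : ℕ → V) (hw : ∀ n, w n = w (n + 1) ∨ G.Adj (w n) (w (n + 1)))
    (hfin : ∀ n, ∃ N, ∀ m ≥ N, w m ≠ w n) :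
    ∃ (R : Ray G) (i : ℕ → ℕ), StrictMono i ∧ ∀ n, R.vert n = w (i n) := by
  have hlast : ∀ n, ∃ l, n ≤ l ∧ w l = w n ∧ ∀ m > l, w m ≠ w n := by
    intro n
    obtain ⟨N, hN⟩ := hfin n
    have hne : ({l | w l = w n} : Set ℕ).Nonempty := ⟨n, rfl⟩
    have hbdd : BddAbove ({l | w l = w n} : Set ℕ) := ⟨N, fun m hm => by
      by_contra hcon
      exact hN m (by omega) hm⟩
    refine ⟨sSup {l | w l = w n}, le_csSup hbdd rfl, Nat.sSup_mem hne hbdd, fun m hm he => ?_⟩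
    exact absurd (le_csSup hbdd he) (by omega)
  -- Loop erasure: `l n` is the last visit to the vertex `w n`. The ray uses only last visits, each
  -- the last visit to the vertex that follows the previous one.
  choose l hl hwl hmax using hlast
  let i : ℕ → ℕ := Nat.rec (l 0) fun _ k => l (k + 1)
  have hi : ∀ n, i (n + 1) = l (i n + 1) := fun _ => rfl
  have hmono : StrictMono i := strictMono_nat_of_lt_succ fun n => by
    rw [hi]; exact hl (i n + 1)
  have himax : ∀ n, ∀ m > i n, w m ≠ w (i n) := by
    intro n m hm
    cases n with
    | zero =>
      have := hmax 0 m hm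
      rwa [← hwl 0] at this
    | succ n =>
      have := hmax (i n + 1) m hm
      rwa [← hwl (i n + 1)] at this
  refine ⟨⟨fun n => w (i n), ?_, ?_⟩, i, hmono, fun _ => rfl⟩
  · intro m n hmn
    rcases lt_trichotomy m n with h | h | h
    · exact absurd hmn.symm (himax m _ (hmono h))
    · exact h
    · exact absurd hmn (himax n _ (hmono h))
  · intro n
    rw [hi, hwl]
    exact (hw (i n)).resolve_left fun h => himax n _ (Nat.lt_succ_self _) h.symm

theorem IsCoarseLine.exists_positive {f : V → ℤ} {K : ℕ} (h : IsCoarseLine G f K)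
    (hG : G.Connected) : ∃ R : Ray G, IsCoarseLine.Positive f R := by
  choose y hy using fun n : ℕ => h.dense n
  have hy' := fun n => abs_le.1 (hy n)
  set L := K * (2 * K + 1) + K + 1 with hL
  have hdist : ∀ n, G.dist (y n) (y (n + 1)) < L := by
    intro n
    have h1 := h.lower (y n) (y (n + 1))
    have h2 : |f (y n) - f (y (n + 1))| ≤ 2 * K + 1 := by
      have h3 := hy' n
      have h4 := hy' (n + 1)
      push_cast at h4
      rw [abs_le]
      constructor <;> linarith [h3.1, h3.2, h4.1, h4.2]
    have : (K : ℤ) * |f (y n) - f (y (n + 1))| ≤ K * (2 * K + 1) := by gcongr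
    zify
    rw [hL]
    push_cast
    linarith
  choose p hp using fun n => hG.exists_walk_length_eq_dist (y n) (y (n + 1))
  have hlen : ∀ n, (p n).length < L := fun n => (hp n).trans_lt (hdist n)
  have hL0 : 0 < L := by omega
  -- Each block of `L` indices runs along one geodesic and then waits at its end. As all lengths are
  -- strictly below `L`, the end is reached by the last index of the block, so blocks fit together.
  let w : ℕ → V := fun m => (p (m / L)).getVert (m % L)
  have hbig : ∀ m, (m / L : ℕ) - K - (K * L + K) ≤ f (w m) := by
    intro m
    have h1 := h.upper (y (m / L)) (w m)
    have h2 : G.dist (y (m / L)) (w m) ≤ L :=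
      (SimpleGraph.dist_le ((p (m / L)).take (m % L))).trans
        (by rw [SimpleGraph.Walk.take_length]; have := Nat.mod_lt m hL0; omega)
    have h3 : (K : ℤ) * G.dist (y (m / L)) (w m) ≤ K * L := by gcongr
    linarith [(hy' (m / L)).1, (abs_le.1 h1).2]
  have htend : ∀ M : ℤ, ∃ N, ∀ m ≥ N, M < f (w m) := by
    intro M
    refine ⟨(M + K + (K * L + K) + 1).toNat * L, fun m hm => ?_⟩
    have h1 := (Nat.le_div_iff_mul_le hL0).2 hm
    have h2 := hbig m
    have h3 := Int.self_le_toNat (M + K + (K * L + K) + 1)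
    have h4 : ((M + K + (K * L + K) + 1).toNat : ℤ) ≤ (m / L : ℕ) := by exact_mod_cast h1
    linarith
  have hstep : ∀ n, w n = w (n + 1) ∨ G.Adj (w n) (w (n + 1)) := by
    intro n
    have hlt := Nat.mod_lt n hL0
    have hdm := Nat.mod_add_div n L
    by_cases hn : n % L + 1 = L
    · left
      obtain ⟨hdiv, hmod⟩ := (Nat.div_mod_unique (a := n + 1) (c := 0) (d := n / L + 1) hL0).2
        ⟨by rw [mul_add]; omega, hL0⟩
      show (p (n / L)).getVert (n % L) = (p ((n + 1) / L)).getVert ((n + 1) % L)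
      rw [hmod, SimpleGraph.Walk.getVert_zero, hdiv, SimpleGraph.Walk.getVert_of_length_le]
      have := hlen (n / L)
      omega
    · obtain ⟨hdiv, hmod⟩ := (Nat.div_mod_unique (a := n + 1) (c := n % L + 1) (d := n / L) hL0).2
        ⟨by omega, by omega⟩
      show (p (n / L)).getVert (n % L) = (p ((n + 1) / L)).getVert ((n + 1) % L) ∨
        G.Adj ((p (n / L)).getVert (n % L)) ((p ((n + 1) / L)).getVert ((n + 1) % L))
      rw [hmod, hdiv]
      rcases lt_or_ge (n % L) (p (n / L)).length with hlt | hge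
      · exact Or.inr ((p (n / L)).adj_getVert_succ hlt)
      · left
        rw [SimpleGraph.Walk.getVert_of_length_le _ hge,
          SimpleGraph.Walk.getVert_of_length_le _ (by omega)]
  obtain ⟨R, i, hi, hR⟩ := exists_ray_of_sequence w hstep fun n => by
    obtain ⟨N, hN⟩ := htend (f (w n))
    exact ⟨N, fun m hm he => (hN m hm).ne (by rw [he])⟩
  refine ⟨R, fun M => ?_⟩
  obtain ⟨N, hN⟩ := htend M
  exact ⟨N, fun n hn => by rw [hR]; exact hN _ (hn.trans hi.le_apply)⟩

theorem isTwoEnded_of_quasiIsometric (hG : G.Connected) (hdom : NoDominatedEnd G)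
    (h : QuasiIsometric G doubleRay) : IsTwoEnded G := by
  obtain ⟨f, K, hf⟩ := h.exists_isCoarseLine
  obtain ⟨R, hR⟩ := hf.exists_positive hG
  obtain ⟨Q, hQ⟩ := hf.neg.exists_positive hG
  refine isTwoEnded_iff.2 ⟨R, Q, hf.not_equivalent hG hdom hR hQ, fun P => ?_⟩
  exact (hf.positive_or hG hdom P).imp (fun hP => hf.equivalent hG hP hR)
    (fun hP => hf.neg.equivalent hG hP hQ)

end CoarseLine

/-- A map between vertex sets that sends edges to edges or single vertices does not increase the
length of walks. -/
theorem exists_walk_of_weak_hom {V V' : Type*} {G : SimpleGraph V} {G' : SimpleGraph V'}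
    (f : V → V') (hf : ∀ x y, G.Adj x y → f x = f y ∨ G'.Adj (f x) (f y)) {x y : V}
    (p : G.Walk x y) : ∃ q : G'.Walk (f x) (f y), q.length ≤ p.length := by
  induction p with
  | nil => exact ⟨.nil, le_rfl⟩
  | @cons a b c h p ih =>
    obtain ⟨q, hq⟩ := ih
    rcases hf a b h with he | ha
    · exact ⟨q.copy he.symm rfl, by simp; omega⟩
    · exact ⟨.cons ha q, by simpa using hq⟩

theorem abs_sub_le_mul_walk_length {V : Type*} {G : SimpleGraph V} (f : V → ℤ) (k : ℤ)
    (hf : ∀ x y, G.Adj x y → |f x - f y| ≤ k) {x y : V} (p : G.Walk x y) :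
    |f x - f y| ≤ k * p.length := by
  induction p with
  | nil => simp
  | @cons a b c h p ih =>
    have h1 := hf a b h
    have h2 := abs_sub_le (f a) (f b) (f c)
    rw [SimpleGraph.Walk.length_cons]
    push_cast
    linarith

theorem _root_.SimpleGraph.Iso.dist_eq {V V' : Type*} {G : SimpleGraph V} {G' : SimpleGraph V'}
    (e : G ≃g G') (hG : G.Connected) (x y : V) : G'.dist (e x) (e y) = G.dist x y := by
  have hG' : G'.Connected := (e.connected_iff).1 hG
  apply le_antisymm
  · obtain ⟨p, hp⟩ := hG.exists_walk_length_eq_dist x y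
    rw [← hp, ← p.length_map e.toHom]
    exact SimpleGraph.dist_le (p.map e.toHom)
  · obtain ⟨p, hp⟩ := hG'.exists_walk_length_eq_dist (e x) (e y)
    rw [← hp, ← p.length_map e.symm.toHom]
    rw [← SimpleGraph.Walk.length_copy (p.map e.symm.toHom)
      (e.symm_apply_apply x) (e.symm_apply_apply y)]
    exact SimpleGraph.dist_le _

/-! ### Tree-amalgamations over the double ray are quasi-isometric to it -/

namespace TreeAmalgamation

section Quasi

variable {U₁ U₂ K L : Type*} {Γ₁ : SimpleGraph U₁} {Γ₂ : SimpleGraph U₂}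

variable (A : TreeAmalgamation Γ₁ Γ₂ doubleRay K L)

/-- The vertex of the tree-amalgamation represented by a vertex of one of the copies. -/
def toVertex (p : A.PreVertex) : A.Vertex := Quot.mk _ p

/-- The vertex of the tree whose copy contains the given vertex. -/
def index : A.PreVertex → ℤ
  | Sum.inl (s, _) => s
  | Sum.inr (t, _) => t

/-- The vertices of the tree whose copies meet the vertex represented by `p`. -/
def indexSet (p : A.PreVertex) : Set ℤ :=
  {n | n = A.index p ∨ ∃ q, (A.Glue p q ∨ A.Glue q p) ∧ A.index q = n}

variable {A}

theorem abs_index_sub_le_of_glue {p q : A.PreVertex} (h : A.Glue p q) :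
    |A.index p - A.index q| ≤ 1 := by
  rcases p with ⟨s, x⟩ | ⟨t, y⟩ <;> rcases q with ⟨s', x'⟩ | ⟨t', y'⟩
  · exact h.elim
  · obtain ⟨h, -⟩ := h
    show |(s : ℤ) - t'| ≤ 1
    rcases h with h | h <;> rw [h] <;> simp
  · exact h.elim
  · exact h.elim

theorem abs_sub_index_le {p : A.PreVertex} {n : ℤ} (h : n ∈ A.indexSet p) :
    |n - A.index p| ≤ 1 := by
  rcases h with rfl | ⟨q, hq | hq, rfl⟩
  · simp
  · rw [abs_sub_comm]; exact abs_index_sub_le_of_glue hq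
  · exact abs_index_sub_le_of_glue hq

/-- A point lies in at most one adhesion of its copy, and the labels determine the neighbouring
copy, so a glued pair `p`, `q` meets no third copy: both sets equal `{index p, index q}`. -/
theorem indexSet_eq_of_glue (h₁ : Pairwise fun k l => Disjoint (A.adh₁ k) (A.adh₁ l))
    (h₂ : Pairwise fun k l => Disjoint (A.adh₂ k) (A.adh₂ l)) {p q : A.PreVertex}
    (h : A.Glue p q) : A.indexSet p = A.indexSet q := by
  have key₁ : A.indexSet p = {A.index p, A.index q} := by
    apply Set.Subset.antisymm
    · rintro n (rfl | ⟨r, hr | hr, rfl⟩)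
      · exact Or.inl rfl
      · right
        rcases p with ⟨s, x⟩ | ⟨t, y⟩ <;> rcases q with ⟨s', x'⟩ | ⟨t', y'⟩ <;>
          rcases r with ⟨s'', x''⟩ | ⟨t'', y''⟩ <;> try exact hr.elim
        all_goals try exact h.elim
        obtain ⟨hadj, hx, -⟩ := h
        obtain ⟨hadj', hx', -⟩ := hr
        have hk := h₁.eq (Set.not_disjoint_iff.2 ⟨x, hx, hx'⟩)
        have := (A.label_bijective₁ s s.2).1
          (a₁ := ⟨t', hadj⟩) (a₂ := ⟨t'', hadj'⟩) hk
        exact (congrArg Subtype.val this).symm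
      · rcases p with ⟨s, x⟩ | ⟨t, y⟩ <;> rcases q with ⟨s', x'⟩ | ⟨t', y'⟩ <;>
          rcases r with ⟨s'', x''⟩ | ⟨t'', y''⟩ <;> first | exact hr.elim | exact h.elim
    · rintro n (rfl | rfl)
      exacts [Or.inl rfl, Or.inr ⟨q, Or.inl h, rfl⟩]
  have key₂ : A.indexSet q = {A.index p, A.index q} := by
    apply Set.Subset.antisymm
    · rintro n (rfl | ⟨r, hr | hr, rfl⟩)
      · exact Or.inr rfl
      · rcases p with ⟨s, x⟩ | ⟨t, y⟩ <;> rcases q with ⟨s', x'⟩ | ⟨t', y'⟩ <;>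
          rcases r with ⟨s'', x''⟩ | ⟨t'', y''⟩ <;> first | exact hr.elim | exact h.elim
      · left
        rcases p with ⟨s, x⟩ | ⟨t, y⟩ <;> rcases q with ⟨s', x'⟩ | ⟨t', y'⟩ <;>
          rcases r with ⟨s'', x''⟩ | ⟨t'', y''⟩ <;> try exact hr.elim
        all_goals try exact h.elim
        obtain ⟨hadj, hx, hy⟩ := h
        obtain ⟨hadj', hx', hy'⟩ := hr
        have hk := h₂.eq (Set.not_disjoint_iff.2
          ⟨y', hy ▸ Subtype.coe_prop _, hy' ▸ Subtype.coe_prop _⟩)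
        have := (A.label_bijective₂ t' t'.2).1
          (a₁ := ⟨s, hadj.symm⟩) (a₂ := ⟨s'', hadj'.symm⟩) (by
            simp only [Sym2.eq_swap (a := (t' : ℤ))]
            exact hk)
        exact (congrArg Subtype.val this).symm
    · rintro n (rfl | rfl)
      exacts [Or.inr ⟨p, Or.inr h, rfl⟩, Or.inl rfl]
  rw [key₁, key₂]

/-- The index set is invariant under gluing, so an element of it can be chosen for each vertex of
the quotient. -/
theorem exists_height (h₁ : Pairwise fun k l => Disjoint (A.adh₁ k) (A.adh₁ l))
    (h₂ : Pairwise fun k l => Disjoint (A.adh₂ k) (A.adh₂ l)) :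
    ∃ f : A.Vertex → ℤ, ∀ p : A.PreVertex, |f (A.toVertex p) - A.index p| ≤ 1 := by
  let N : A.Vertex → Set ℤ :=
    Quot.lift A.indexSet fun p q h => indexSet_eq_of_glue h₁ h₂ h
  have hN : ∀ a, (N a).Nonempty := by
    rintro ⟨p⟩
    exact ⟨A.index p, Or.inl rfl⟩
  exact ⟨fun a => (hN a).choose, fun p => abs_sub_index_le (hN (A.toVertex p)).choose_spec⟩

theorem index_eq_of_preAdj {p q : A.PreVertex} (h : A.PreAdj p q) : A.index p = A.index q := by
  rcases p with ⟨s, x⟩ | ⟨t, y⟩ <;> rcases q with ⟨s', x'⟩ | ⟨t', y'⟩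
  · exact congrArg Subtype.val h.1
  · exact h.elim
  · exact h.elim
  · exact congrArg Subtype.val h.1

theorem exists_index_eq [Nonempty U₁] [Nonempty U₂] (n : ℤ) :
    ∃ p : A.PreVertex, A.index p = n := by
  by_cases hn : n ∈ A.side₁
  · exact ⟨Sum.inl (⟨n, hn⟩, Classical.arbitrary _), rfl⟩
  · exact ⟨Sum.inr (⟨n, hn⟩, Classical.arbitrary _), rfl⟩

theorem eq_or_adj_of_preAdj {p q : A.PreVertex} (h : A.PreAdj p q) :
    A.toVertex p = A.toVertex q ∨ A.graph.Adj (A.toVertex p) (A.toVertex q) := by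
  by_cases he : A.toVertex p = A.toVertex q
  exacts [Or.inl he, Or.inr ⟨he, p, q, h, rfl, rfl⟩]

theorem exists_walk_of_index_eq (hΓ₁ : Γ₁.Connected) (hΓ₂ : Γ₂.Connected) {D : ℕ}
    (hD₁ : ∀ x y, Γ₁.dist x y ≤ D) (hD₂ : ∀ x y, Γ₂.dist x y ≤ D) {p q : A.PreVertex}
    (h : A.index p = A.index q) :
    ∃ w : A.graph.Walk (A.toVertex p) (A.toVertex q), w.length ≤ D := by
  rcases p with ⟨s, x⟩ | ⟨t, y⟩ <;> rcases q with ⟨s', x'⟩ | ⟨t', y'⟩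
  · obtain rfl : s = s' := Subtype.ext h
    obtain ⟨w, hw⟩ := hΓ₁.exists_walk_length_eq_dist x x'
    obtain ⟨w', hw'⟩ := exists_walk_of_weak_hom (G' := A.graph)
      (fun x => A.toVertex (Sum.inl (s, x))) (fun x y hxy =>
        eq_or_adj_of_preAdj (p := Sum.inl (s, x)) (q := Sum.inl (s, y)) ⟨rfl, hxy⟩) w
    exact ⟨w', hw'.trans (hw.trans_le (hD₁ _ _))⟩
  · have h' : (s : ℤ) = t' := h
    exact absurd (h' ▸ s.2) t'.2
  · have h' : (t : ℤ) = s' := h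
    exact absurd (h' ▸ s'.2) t.2
  · obtain rfl : t = t' := Subtype.ext h
    obtain ⟨w, hw⟩ := hΓ₂.exists_walk_length_eq_dist y y'
    obtain ⟨w', hw'⟩ := exists_walk_of_weak_hom (G' := A.graph)
      (fun x => A.toVertex (Sum.inr (t, x))) (fun x y hxy =>
        eq_or_adj_of_preAdj (p := Sum.inr (t, x)) (q := Sum.inr (t, y)) ⟨rfl, hxy⟩) w
    exact ⟨w', hw'.trans (hw.trans_le (hD₂ _ _))⟩

theorem exists_glued (h₁ : ∀ k, (A.adh₁ k).Nonempty) (n : ℤ) :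
    ∃ p q : A.PreVertex, A.toVertex p = A.toVertex q ∧ A.index p = n ∧
      A.index q = n + 1 := by
  have hadj : doubleRay.Adj n (n + 1) := Or.inl rfl
  have hbip := A.bipartition _ _ hadj
  by_cases hn : n ∈ A.side₁
  · have hn' : n + 1 ∉ A.side₁ := hbip.1 hn
    obtain ⟨x, hx⟩ := h₁ (A.label ⟨s(n, n + 1), hadj⟩).1
    exact ⟨Sum.inl (⟨n, hn⟩, x), Sum.inr (⟨n + 1, hn'⟩, A.φ _ _ ⟨x, hx⟩),
      Quot.sound ⟨hadj, hx, rfl⟩, rfl, rfl⟩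
  · have hn' : n + 1 ∈ A.side₁ := by
      by_contra hcon
      exact hn (hbip.2 hcon)
    obtain ⟨x, hx⟩ := h₁ (A.label ⟨s(n + 1, n), hadj.symm⟩).1
    exact ⟨Sum.inr (⟨n, hn⟩, A.φ _ _ ⟨x, hx⟩), Sum.inl (⟨n + 1, hn'⟩, x),
      (Quot.sound ⟨hadj.symm, hx, rfl⟩).symm, rfl, rfl⟩

/-- The walk traverses `k + 1` consecutive copies, each at cost at most `D`, changing copies at
shared vertices. -/
theorem exists_walk_of_index_add (hΓ₁ : Γ₁.Connected) (hΓ₂ : Γ₂.Connected)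
    (h₁ : ∀ k, (A.adh₁ k).Nonempty) {D : ℕ}
    (hD₁ : ∀ x y, Γ₁.dist x y ≤ D) (hD₂ : ∀ x y, Γ₂.dist x y ≤ D) (k : ℕ) {p q : A.PreVertex}
    (h : A.index q = A.index p + k) :
    ∃ w : A.graph.Walk (A.toVertex p) (A.toVertex q), w.length ≤ D * (k + 1) := by
  induction k generalizing q with
  | zero =>
    obtain ⟨w, hw⟩ := exists_walk_of_index_eq hΓ₁ hΓ₂ hD₁ hD₂ (p := p) (q := q) (by simp [h])
    exact ⟨w, by simpa using hw⟩
  | succ k ih =>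
    obtain ⟨a, b, hab, ha, hb⟩ := exists_glued (A := A) h₁ (A.index p + k)
    obtain ⟨w, hw⟩ := ih ha
    obtain ⟨w', hw'⟩ := exists_walk_of_index_eq hΓ₁ hΓ₂ hD₁ hD₂ (p := b) (q := q)
      (by rw [hb, h]; push_cast; ring)
    refine ⟨w.append (w'.copy hab.symm rfl), ?_⟩
    rw [SimpleGraph.Walk.length_append, SimpleGraph.Walk.length_copy]
    linarith

theorem dist_le_of_index (hΓ₁ : Γ₁.Connected) (hΓ₂ : Γ₂.Connected)
    (h₁ : ∀ k, (A.adh₁ k).Nonempty) {D : ℕ}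
    (hD₁ : ∀ x y, Γ₁.dist x y ≤ D) (hD₂ : ∀ x y, Γ₂.dist x y ≤ D) (p q : A.PreVertex) :
    (A.graph.dist (A.toVertex p) (A.toVertex q) : ℤ) ≤ D * (|A.index p - A.index q| + 1) := by
  have key : ∀ p q : A.PreVertex, A.index p ≤ A.index q →
      (A.graph.dist (A.toVertex p) (A.toVertex q) : ℤ) ≤ D * (|A.index p - A.index q| + 1) := by
    intro p q hpq
    obtain ⟨k, hk⟩ := Int.le.dest hpq
    obtain ⟨w, hw⟩ := exists_walk_of_index_add hΓ₁ hΓ₂ h₁ hD₁ hD₂ k hk.symm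
    have := (SimpleGraph.dist_le w).trans hw
    rw [← hk]
    simp only [sub_add_cancel_left, abs_neg, Nat.abs_cast]
    exact_mod_cast this
  rcases le_total (A.index p) (A.index q) with h | h
  · exact key p q h
  · rw [SimpleGraph.dist_comm, abs_sub_comm]
    exact key q p h

end Quasi

end TreeAmalgamation

theorem quasiIsometric_of_splits {V : Type u} {G : SimpleGraph V} (hG : G.Connected)
    (h : SplitsAsStronglyThin G) : QuasiIsometric G doubleRay := by
  obtain ⟨U, Γ, A, ⟨e⟩, -, ⟨hΓ, -, hdiam⟩, ⟨N, H, ι, hι₁, hι₂, -⟩, hadh, hdisj⟩ := h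
  have hadh₁ : ∀ k, (A.adh₁ k).Nonempty := fun k =>
    Set.nonempty_coe_sort.1 (hadh k).2.nonempty
  -- Both families of adhesions are the ranges of the same embeddings `ι`.
  have hdisj₂ : Pairwise fun k l => Disjoint (A.adh₂ k) (A.adh₂ l) := by
    intro k l hkl
    rw [← hι₂, ← hι₂, hι₁, hι₁]
    exact hdisj hkl
  obtain ⟨f, hf⟩ := TreeAmalgamation.exists_height hdisj hdisj₂
  have hD : ∀ x y, Γ.dist x y ≤ Γ.diam := fun x y => SimpleGraph.dist_le_diam hdiam
  set D := Γ.diam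
  have := hΓ.nonempty
  have hlip : ∀ a b, A.graph.Adj a b → |f a - f b| ≤ 2 := by
    rintro _ _ ⟨-, p, q, hpq, rfl, rfl⟩
    have h1 := abs_le.1 (hf p)
    have h2 := abs_le.1 (hf q)
    rw [TreeAmalgamation.index_eq_of_preAdj hpq] at h1
    change |f (A.toVertex p) - f (A.toVertex q)| ≤ 2
    rw [abs_le]
    constructor <;> linarith [h1.1, h1.2, h2.1, h2.2]
  have hd : ∀ i j : ℤ, (doubleRay.dist i j : ℝ) = ((|i - j| : ℤ) : ℝ) := fun i j => by
    rw [← doubleRay_dist]; simp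
  -- The height differs from an index by at most 1 at either end, so distances are at most `D` times
  -- the height difference plus `3 * D`, while heights are 2-Lipschitz; `D + 3` absorbs all these
  -- constants.
  refine ⟨fun v => f (e v), ⟨D + 3, by linarith [Nat.cast_nonneg (α := ℝ) D], fun x y => ?_⟩,
    1, fun n => ?_⟩
  · rw [hd, ← e.dist_eq hG x y]
    have hlow : (A.graph.dist (e x) (e y) : ℤ) ≤ D * (|f (e x) - f (e y)| + 3) := by
      obtain ⟨p, hp⟩ := Quot.exists_rep (e x)
      obtain ⟨q, hq⟩ := Quot.exists_rep (e y)
      rw [← hp, ← hq]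
      change (A.graph.dist (A.toVertex p) (A.toVertex q) : ℤ) ≤
        D * (|f (A.toVertex p) - f (A.toVertex q)| + 3)
      refine (TreeAmalgamation.dist_le_of_index hΓ hΓ hadh₁ hD hD p q).trans ?_
      have h1 := abs_le.1 (hf p)
      have h2 := abs_le.1 (hf q)
      have : |A.index p - A.index q| ≤ |f (A.toVertex p) - f (A.toVertex q)| + 2 := by
        have h3 := abs_le.1 (le_refl |f (A.toVertex p) - f (A.toVertex q)|)
        rw [abs_le]
        constructor <;> linarith [h1.1, h1.2, h2.1, h2.2, h3.1, h3.2]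
      have : |A.index p - A.index q| + 1 ≤ |f (A.toVertex p) - f (A.toVertex q)| + 3 := by linarith
      gcongr
    have hup : |f (e x) - f (e y)| ≤ 2 * A.graph.dist (e x) (e y) := by
      obtain ⟨p, hp⟩ := ((e.connected_iff).1 hG).exists_walk_length_eq_dist (e x) (e y)
      rw [← hp]
      exact abs_sub_le_mul_walk_length f 2 hlip p
    have hlow' : (A.graph.dist (e x) (e y) : ℝ) ≤ D * (((|f (e x) - f (e y)| : ℤ) : ℝ) + 3) := by
      exact_mod_cast hlow
    have hup' : ((|f (e x) - f (e y)| : ℤ) : ℝ) ≤ 2 * A.graph.dist (e x) (e y) := by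
      exact_mod_cast hup
    have hnn : (0 : ℝ) ≤ ((|f (e x) - f (e y)| : ℤ) : ℝ) := by exact_mod_cast abs_nonneg _
    have hD0 : (0 : ℝ) ≤ D := Nat.cast_nonneg _
    have hd0 : (0 : ℝ) ≤ A.graph.dist (e x) (e y) := Nat.cast_nonneg _
    constructor
    · rw [sub_le_iff_le_add, one_div, inv_mul_le_iff₀ (by linarith)]
      nlinarith
    · nlinarith
  · obtain ⟨p, hp⟩ := TreeAmalgamation.exists_index_eq (A := A) n
    refine ⟨e.symm (A.toVertex p), ?_⟩
    have := hf p
    rw [hp] at this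
    beta_reduce
    rw [hd, show e (e.symm (A.toVertex p)) = A.toVertex p from e.apply_symm_apply _]
    exact_mod_cast this

/-! ### The action of automorphisms on rays and components -/

section Automorphisms

variable {V : Type u} {G : SimpleGraph V}

/-- The image of a ray under an automorphism. -/
def Ray.map (g : G ≃g G) (R : Ray G) : Ray G where
  vert n := g (R.vert n)
  injective := g.injective.comp R.injective
  adj n := g.map_adj_iff.2 (R.adj n)

theorem SameComponent.map (g : G ≃g G) {S : Set V} {u v : V} (h : SameComponent G S u v) :
    SameComponent G (g '' S) (g u) (g v) := by
  obtain ⟨p, hp⟩ := h.exists_walk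
  refine .of_walk (p.map g.toHom) fun x hx => ?_
  rw [SimpleGraph.Walk.support_map, List.mem_map] at hx
  obtain ⟨y, hy, rfl⟩ := hx
  exact fun h => hp y hy ((g.injective.mem_set_image).1 h)

theorem image_inv_image (g : G ≃g G) (S : Set V) : (g⁻¹ : G ≃g G) '' (g '' S) = S := by
  rw [Set.image_image]
  simp

theorem Ray.map_inv_map (g : G ≃g G) (R : Ray G) : (R.map g).map g⁻¹ = R := by
  cases R
  simp [Ray.map]

theorem mem_live_map (g : G ≃g G) {S : Set V} {R : Ray G} {v : V} (h : v ∈ live G S R) :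
    g v ∈ live G (g '' S) (R.map g) := by
  obtain ⟨N, hN⟩ := h
  exact ⟨N, fun n hn => (hN n hn).map g⟩

theorem live_map (g : G ≃g G) (S : Set V) (R : Ray G) :
    live G (g '' S) (R.map g) = g '' live G S R := by
  apply Set.Subset.antisymm
  · intro v hv
    have := mem_live_map g⁻¹ hv
    rw [image_inv_image, Ray.map_inv_map] at this
    exact ⟨_, this, by simp⟩
  · rintro _ ⟨v, hv, rfl⟩
    exact mem_live_map g hv

theorem Ray.Equivalent.map (g : G ≃g G) {R Q : Ray G} (h : R.Equivalent Q) :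
    (R.map g).Equivalent (Q.map g) := by
  classical
  intro S
  obtain ⟨N, hN⟩ := h (S.image (g⁻¹ : G ≃g G))
  refine ⟨N, fun m hm n hn => ?_⟩
  have := (hN m hm n hn).map g
  rw [Finset.coe_image, Set.image_image] at this
  simpa [Ray.map] using this

theorem connected_induce_image (g : G ≃g G) {S : Set V} (hS : (G.induce S).Connected) :
    (G.induce (g '' S)).Connected :=
  (SimpleGraph.Iso.connected_iff (g.induce (g.injective.injOn.bijOn_image (s := S)))).1 hS

end Automorphisms

/-! ### Nested separators and translations -/

section Separators

variable {V : Type u} {G : SimpleGraph V}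

/-- The set `S` is finite, connected and separates the ends of the rays `R` and `Q`. -/
structure IsSeparator (R Q : Ray G) (S : Set V) : Prop where
  finite : S.Finite
  connected : (G.induce S).Connected
  disjoint : Disjoint (live G S R) (live G S Q)

namespace IsSeparator

variable {R Q : Ray G} {A B S : Set V}

theorem symm (h : IsSeparator R Q S) : IsSeparator Q R S :=
  ⟨h.finite, h.connected, h.disjoint.symm⟩

theorem nonempty (h : IsSeparator R Q S) : S.Nonempty :=
  Set.nonempty_coe_sort.1 h.connected.nonempty

theorem congr {R' Q' : Ray G} (h : IsSeparator R Q S) (hR : R.Equivalent R')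
    (hQ : Q.Equivalent Q') : IsSeparator R' Q' S :=
  ⟨h.finite, h.connected, by
    rw [← live_congr h.finite hR, ← live_congr h.finite hQ]; exact h.disjoint⟩

theorem map (h : IsSeparator R Q S) (g : G ≃g G) : IsSeparator (R.map g) (Q.map g) (g '' S) :=
  ⟨h.finite.image g, connected_induce_image g h.connected, by
    rw [live_map, live_map]
    exact (Set.disjoint_image_iff g.injective).2 h.disjoint⟩

theorem not_equivalent (h : IsSeparator R Q S) : ¬ R.Equivalent Q :=
  not_equivalent_of_disjoint h.finite h.disjoint

/-- If a connected set `A` and the component of `G - A` in which the ray `Q` lives both avoid the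
finite set `B`, then they are contained in the component of `G - B` in which `Q` lives. -/
theorem subset_live_of_disjoint (hG : G.Connected) (hA : A.Finite) (hAc : (G.induce A).Connected)
    (hAB : Disjoint B A) (hBQ : Disjoint B (live G A Q)) :
    A ⊆ live G B Q ∧ live G A Q ⊆ live G B Q := by
  have h1 : live G A Q ⊆ live G B Q := by
    rintro v ⟨N, hN⟩
    refine ⟨N, fun n hn => ?_⟩
    obtain ⟨p, hp⟩ := (hN n hn).exists_walk
    exact .of_walk p fun x hx =>
      Set.disjoint_right.1 hBQ (mem_of_walk_of_closed live_closed p hp ⟨N, hN⟩ x hx)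
  refine ⟨fun a ha => ?_, h1⟩
  obtain ⟨w, hw⟩ := live_nonempty hA Q
  obtain ⟨u, s, hs, hus, hwu⟩ := exists_adj_of_connected hG ⟨a, ha⟩ (notMem_of_mem_live hw)
  have hu := h1 (live_of_sameComponent hw hwu)
  refine live_of_sameComponent (live_closed u hu s hus (Set.disjoint_right.1 hAB hs)) ?_
  exact .of_connected hAc.preconnected hAB hs ha

/-- Nestedness: a set on the `R`-side of `A` meets neither `A` nor its `Q`-side, so it cannot cut
these apart from the end of `Q`. -/
theorem subset_live (hG : G.Connected) (hA : IsSeparator R Q A)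
    (h : B ⊆ live G A R) : A ⊆ live G B Q ∧ live G A Q ⊆ live G B Q :=
  subset_live_of_disjoint hG hA.finite hA.connected
    (Set.disjoint_of_subset_left h (disjoint_live A R).symm)
    (Set.disjoint_of_subset_left h hA.disjoint)

end IsSeparator

/-- A finite separating set can be enlarged to a finite connected one; enlarging only shrinks the
components of the ends. -/
theorem exists_isSeparator (hG : G.Connected) {R Q : Ray G} (h : ¬ R.Equivalent Q) :
    ∃ S, IsSeparator R Q S := by
  classical
  obtain ⟨S, hS⟩ := exists_disjoint_live h
  obtain ⟨v⟩ := hG.nonempty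
  obtain ⟨T, hST, hT⟩ := SimpleGraph.extend_finset_to_connected (G := G) hG.preconnected
    (t := insert v S) ⟨v, by simp⟩
  have hsub : (S : Set V) ⊆ T := fun x hx => hST (by simp [Finset.mem_coe.1 hx])
  exact ⟨T, T.finite_toSet, hT,
    Set.disjoint_of_subset (live_anti hsub R) (live_anti hsub Q) hS⟩

/-- In a quasi-transitive graph, copies of a fixed finite set are found near every vertex. -/
theorem exists_forall_exists_dist_le (hG : G.Connected) (hqt : IsQuasiTransitive G) {S : Set V}
    (hS : S.Finite) : ∃ r : ℕ, ∀ v, ∃ g : G ≃g G, ∀ s ∈ S, G.dist v (g s) ≤ r := by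
  obtain ⟨F, hF⟩ := hqt
  obtain ⟨r, hr⟩ := ((F.finite_toSet.prod hS).image fun p => G.dist p.1 p.2).bddAbove
  refine ⟨r, fun v => ?_⟩
  obtain ⟨x, hx, g, rfl⟩ := hF v
  refine ⟨g, fun s hs => ?_⟩
  rw [g.dist_eq hG]
  exact hr ⟨(x, s), ⟨hx, hs⟩, rfl⟩

/-- Far out on `R` there is a vertex whose distance from `S` exceeds `r`, where `r` bounds its
distance to all points of some copy of `S`. Geodesics to that copy then miss `S`. -/
theorem IsSeparator.exists_image_subset_live (hG : G.Connected) (hqt : IsQuasiTransitive G)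
    (hdom : NoDominatedEnd G) {R Q : Ray G} {S : Set V} (hS : IsSeparator R Q S) :
    ∃ g : G ≃g G, g '' S ⊆ live G S R := by
  classical
  obtain ⟨r, hr⟩ := exists_forall_exists_dist_le hG hqt hS.finite
  obtain ⟨s₀, hs₀⟩ := hS.nonempty
  obtain ⟨r', hr'⟩ := (hS.finite.image fun s => G.dist s₀ s).bddAbove
  obtain ⟨N, hN⟩ := eventually_lt_dist hG hdom R (r' + r) s₀
  obtain ⟨M, hM⟩ := eventually_mem_live hS.finite R
  have hfar := hN (max N M) (le_max_left _ _)
  have hlive := hM (max N M) (le_max_right _ _)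
  set v := R.vert (max N M)
  obtain ⟨g, hg⟩ := hr v
  refine ⟨g, ?_⟩
  rintro _ ⟨s, hs, rfl⟩
  obtain ⟨p, hp⟩ := hG.exists_walk_length_eq_dist v (g s)
  refine live_of_sameComponent hlive (.of_walk p fun x hx hxS => ?_)
  have h1 : G.dist v x ≤ r :=
    (SimpleGraph.dist_le (p.takeUntil x hx)).trans
      ((p.length_takeUntil_le_length hx).trans (hp.trans_le (hg s hs)))
  have h2 : G.dist s₀ x ≤ r' := hr' ⟨x, hxS, rfl⟩
  have h3 := hG.dist_triangle (u := s₀) (v := x) (w := v)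
  rw [SimpleGraph.dist_comm (u := x)] at h3
  omega

/-- The automorphism fixes the ends of both rays. -/
def FixesEnds (R Q : Ray G) (g : G ≃g G) : Prop :=
  (R.map g).Equivalent R ∧ (Q.map g).Equivalent Q

/-- The automorphism exchanges the ends of both rays. -/
def SwapsEnds (R Q : Ray G) (g : G ≃g G) : Prop :=
  (R.map g).Equivalent Q ∧ (Q.map g).Equivalent R

theorem fixesEnds_or_swapsEnds {R Q : Ray G} (hRQ : ¬ R.Equivalent Q)
    (hall : ∀ P : Ray G, P.Equivalent R ∨ P.Equivalent Q) (g : G ≃g G) :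
    FixesEnds R Q g ∨ SwapsEnds R Q g := by
  have hne : ¬ (R.map g).Equivalent (Q.map g) := by
    intro h
    have := h.map g⁻¹
    rw [Ray.map_inv_map, Ray.map_inv_map] at this
    exact hRQ this
  rcases hall (R.map g) with h1 | h1 <;> rcases hall (Q.map g) with h2 | h2
  · exact absurd (h1.trans h2.symm) hne
  · exact Or.inl ⟨h1, h2⟩
  · exact Or.inr ⟨h1, h2⟩
  · exact absurd (h1.trans h2.symm) hne

theorem FixesEnds.inv {R Q : Ray G} {g : G ≃g G} (h : FixesEnds R Q g) : FixesEnds R Q g⁻¹ := by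
  have h1 := h.1.map g⁻¹
  have h2 := h.2.map g⁻¹
  rw [Ray.map_inv_map] at h1 h2
  exact ⟨h1.symm, h2.symm⟩

theorem SwapsEnds.inv {R Q : Ray G} {g : G ≃g G} (h : SwapsEnds R Q g) : SwapsEnds R Q g⁻¹ := by
  have h1 := h.1.map g⁻¹
  have h2 := h.2.map g⁻¹
  rw [Ray.map_inv_map] at h1 h2
  exact ⟨h2.symm, h1.symm⟩

theorem SwapsEnds.mul {R Q : Ray G} {g h : G ≃g G} (hg : SwapsEnds R Q g)
    (hh : SwapsEnds R Q h) : FixesEnds R Q (g * h) :=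
  ⟨(hh.1.map g).trans hg.2, (hh.2.map g).trans hg.1⟩

/-- The automorphism `g` fixes both ends and moves the separator `S` towards the end of `R`. -/
structure IsTranslation (R Q : Ray G) (g : G ≃g G) (S : Set V) : Prop where
  isSeparator : IsSeparator R Q S
  fixesEnds : FixesEnds R Q g
  image_subset : g '' S ⊆ live G S R

/-- Let `g` push `S` towards `R` and `h` push it towards `Q`. If one of them fixes the ends, `g` or
`h⁻¹` works. If both swap them, `g * h⁻¹` fixes them and carries `h '' S`, on the `Q`-side of `S`,
to `g '' S`, on the `R`-side. -/
theorem exists_isTranslation (hG : G.Connected) (hqt : IsQuasiTransitive G)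
    (hdom : NoDominatedEnd G) {R Q : Ray G} (hRQ : ¬ R.Equivalent Q)
    (hall : ∀ P : Ray G, P.Equivalent R ∨ P.Equivalent Q) :
    ∃ g S, IsTranslation R Q g S := by
  obtain ⟨S, hS⟩ := exists_isSeparator hG hRQ
  obtain ⟨g, hg⟩ := hS.exists_image_subset_live hG hqt hdom
  obtain ⟨h, hh⟩ := hS.symm.exists_image_subset_live hG hqt hdom
  have hh' := hS.symm.subset_live hG hh
  rcases fixesEnds_or_swapsEnds hRQ hall g with hgf | hgs
  · exact ⟨g, S, hS, hgf, hg⟩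
  rcases fixesEnds_or_swapsEnds hRQ hall h with hhf | hhs
  · refine ⟨h⁻¹, S, hS, hhf.inv, ?_⟩
    rintro _ ⟨s, hs, rfl⟩
    have := mem_live_map h⁻¹ (hh'.1 hs)
    rw [image_inv_image] at this
    exact live_subset_of_equivalent hS.finite hhf.inv.1 this
  · refine ⟨g * h⁻¹, h '' S, (hS.symm.map h).congr hhs.2 hhs.1, hgs.mul hhs.inv, ?_⟩
    have : (g * h⁻¹ : G ≃g G) '' (h '' S) = g '' S := by
      rw [Set.image_image]
      simp
    rw [this]
    exact hg.trans hh'.2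

end Separators

/-! ### The piece between a separator and its translate -/

section Shift

variable {V : Type u} {G : SimpleGraph V}

/-- The automorphism `g` moves the finite connected set `S` and the union `C` of components of
`G - S` into `C`. -/
structure IsShift (g : G ≃g G) (S C : Set V) : Prop where
  finite : S.Finite
  connected : (G.induce S).Connected
  notMem : ∀ s ∈ S, s ∉ C
  closed : ∀ a ∈ C, ∀ b, G.Adj a b → b ∈ S ∪ C
  map_mem : ∀ v ∈ S ∪ C, g v ∈ C

/-- The part of the graph between `S` and its image under the shift. -/
def piece (g : G ≃g G) (S C : Set V) : Set V := {v | v ∈ S ∪ C ∧ g⁻¹ v ∉ C}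

namespace IsShift

variable {g : G ≃g G} {S C : Set V}

theorem mem_of_inv_mem (h : IsShift g S C) {v : V} (hv : g⁻¹ v ∈ S ∪ C) : v ∈ C := by
  simpa using h.map_mem _ hv

theorem mem_piece_of_mem (h : IsShift g S C) {s : V} (hs : s ∈ S) : s ∈ piece g S C :=
  ⟨Or.inl hs, fun hC => h.notMem s hs (h.mem_of_inv_mem (Or.inr hC))⟩

theorem mem_piece_of_inv_mem (h : IsShift g S C) {s : V} (hs : g⁻¹ s ∈ S) : s ∈ piece g S C :=
  ⟨Or.inr (h.mem_of_inv_mem (Or.inl hs)), h.notMem _ hs⟩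

theorem inv_closed (h : IsShift g S C) {a b : V} (ha : g⁻¹ a ∈ C) (hab : G.Adj a b) :
    g⁻¹ b ∈ S ∪ C :=
  h.closed _ ha _ ((g⁻¹ : G ≃g G).map_adj_iff.2 hab)

/-- The piece can only be left through `S` or through its image. -/
theorem boundary (h : IsShift g S C) {v w : V} (hv : v ∈ piece g S C) (hvw : G.Adj v w)
    (hw : w ∉ piece g S C) : v ∈ S ∨ g⁻¹ v ∈ S ∧ g⁻¹ w ∈ C := by
  by_cases hX : w ∈ S ∪ C
  · have hwC : g⁻¹ w ∈ C := by
      by_contra hcon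
      exact hw ⟨hX, hcon⟩
    exact Or.inr ⟨(h.inv_closed hwC hvw.symm).resolve_right hv.2, hwC⟩
  · exact Or.inl (hv.1.resolve_right fun hC => hX (h.closed v hC w hvw))

/-- Follow a walk to `S`. It leaves the piece either at a vertex of `S`, or through `g S` into `g
C`; in the latter case it must return through `g S`, and the detour is replaced by a path in the
connected set `g S`. -/
theorem sameComponent_compl_piece (h : IsShift g S C) (hG : G.Connected) {u v : V}
    (hu : u ∈ piece g S C) (hv : v ∈ piece g S C) :
    SameComponent G (piece g S C)ᶜ u v := by
  have hS : ∀ s ∈ S, ∀ t ∈ S, SameComponent G (piece g S C)ᶜ s t := fun s hs t ht =>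
    .of_connected h.connected.preconnected
      (Set.disjoint_compl_left_iff_subset.2 fun x hx => h.mem_piece_of_mem hx) hs ht
  have hgS : ∀ s t, g⁻¹ s ∈ S → g⁻¹ t ∈ S → SameComponent G (piece g S C)ᶜ s t :=
    fun s t hs ht =>
    .of_connected (connected_induce_image g h.connected).preconnected
      (Set.disjoint_compl_left_iff_subset.2 (by
        rintro _ ⟨x, hx, rfl⟩
        exact h.mem_piece_of_inv_mem (by simpa using hx)))
      ⟨_, hs, by simp⟩ ⟨_, ht, by simp⟩
  -- The second clause treats walks that are currently on a detour in `g C`; `b` stands for the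
  -- point of `g S` where the detour began.
  have key : ∀ a s, ∀ _ : G.Walk a s, s ∈ S →
      (a ∈ piece g S C → ∃ t ∈ S, SameComponent G (piece g S C)ᶜ a t) ∧
      (g⁻¹ a ∈ C → ∀ b, g⁻¹ b ∈ S → ∃ t ∈ S, SameComponent G (piece g S C)ᶜ b t) := by
    intro a s p hs
    induction p with
    | nil =>
      exact ⟨fun _ => ⟨_, hs, hS _ hs _ hs⟩,
        fun ha => absurd (h.mem_of_inv_mem (Or.inr ha)) (h.notMem _ hs)⟩
    | @cons a a' s hadj p ih =>
      obtain ⟨ih₁, ih₂⟩ := ih hs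
      constructor
      · intro ha
        by_cases ha' : a' ∈ piece g S C
        · obtain ⟨t, ht, hat⟩ := ih₁ ha'
          exact ⟨t, ht, (SameComponent.of_adj (by simpa using ha) (by simpa using ha')
            hadj).trans hat⟩
        · rcases h.boundary ha hadj ha' with haS | ⟨haS, haC⟩
          · exact ⟨a, haS, hS a haS a haS⟩
          · exact ih₂ haC a haS
      · intro ha b hb
        rcases h.inv_closed ha hadj with ha' | ha'
        · obtain ⟨t, ht, hat⟩ := ih₁ (h.mem_piece_of_inv_mem ha')
          exact ⟨t, ht, (hgS b a' hb ha').trans hat⟩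
        · exact ih₂ ha' b hb
  obtain ⟨s, hs⟩ := Set.nonempty_coe_sort.1 h.connected.nonempty
  obtain ⟨p⟩ := hG u s
  obtain ⟨q⟩ := hG v s
  obtain ⟨t, ht, hut⟩ := (key u s p hs).1 hu
  obtain ⟨t', ht', hvt⟩ := (key v s q hs).1 hv
  exact hut.trans ((hS t ht t' ht').trans hvt.symm)

theorem connected_piece (h : IsShift g S C) (hG : G.Connected) :
    (G.induce (piece g S C)).Connected := by
  obtain ⟨s, hs⟩ := Set.nonempty_coe_sort.1 h.connected.nonempty
  have : Nonempty (piece g S C) := ⟨⟨s, h.mem_piece_of_mem hs⟩⟩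
  refine ⟨fun u v => ?_⟩
  obtain ⟨p, hp⟩ := (h.sameComponent_compl_piece hG u.2 v.2).exists_walk
  exact ⟨p.induce _ (by simpa using hp)⟩

/-- A walk that starts in the piece and reaches its complement or a set `F` containing its boundary
can be replaced by a walk inside the piece that ends in `F`. -/
theorem exists_walk_piece (h : IsShift g S C) {F : Set V} (hF : F ⊆ piece g S C) (hSF : S ⊆ F)
    (hgSF : ∀ v, g⁻¹ v ∈ S → v ∈ F) {v z : V} (p : G.Walk v z) (hv : v ∈ piece g S C)
    (hz : z ∈ F ∨ z ∉ piece g S C) :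
    ∃ (w : V) (hw : w ∈ F), ∃ q : (G.induce (piece g S C)).Walk ⟨v, hv⟩ ⟨w, hF hw⟩,
      q.length ≤ p.length := by
  induction p with
  | nil => exact ⟨_, hz.resolve_right (not_not_intro hv), .nil, le_rfl⟩
  | @cons a b c hab p ih =>
    by_cases ha : a ∈ F
    · exact ⟨a, ha, .nil, by simp⟩
    · have hb : b ∈ piece g S C := by
        by_contra hb
        rcases h.boundary hv hab hb with h1 | ⟨h1, -⟩
        exacts [ha (hSF h1), ha (hgSF a h1)]
      obtain ⟨w, hw, q, hq⟩ := ih hb hz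
      have hab' : (G.induce (piece g S C)).Adj ⟨a, hv⟩ ⟨b, hb⟩ := hab
      exact ⟨w, hw, .cons hab' q, by simpa using hq⟩

end IsShift

/-- Nestedness is used twice: as `g S` is on the `R`-side of `S`, the set `S` is on the `Q`-side of
`g S`, and hence the `R`-side of `g S` is contained in that of `S`. -/
theorem IsTranslation.isShift (hG : G.Connected) {R Q : Ray G} {g : G ≃g G} {S : Set V}
    (h : IsTranslation R Q g S) : IsShift g S (live G S R) := by
  refine ⟨h.isSeparator.finite, h.isSeparator.connected, fun s hs hC => notMem_of_mem_live hC hs,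
    fun a ha b hab => ?_, ?_⟩
  · by_cases hb : b ∈ S
    exacts [Or.inl hb, Or.inr (live_closed a ha b hab hb)]
  · have h1 := (h.isSeparator.subset_live hG h.image_subset).1
    have h2 : IsSeparator Q R (g '' S) :=
      ((h.isSeparator.map g).congr h.fixesEnds.1 h.fixesEnds.2).symm
    have h3 := (h2.subset_live hG h1).2
    rintro v (hv | hv)
    · exact h.image_subset ⟨v, hv, rfl⟩
    · exact h3 (live_subset_of_equivalent h2.finite h.fixesEnds.1 (mem_live_map g hv))

/-- The component beyond the image of the separator. -/
theorem IsTranslation.inv_mem_live_iff {R Q : Ray G} {g : G ≃g G} {S : Set V}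
    (h : IsTranslation R Q g S) {v : V} : g⁻¹ v ∈ live G S R ↔ v ∈ live G (g '' S) R := by
  rw [← live_congr (h.isSeparator.finite.image g) h.fixesEnds.1, live_map]
  exact ⟨fun hv => ⟨_, hv, by simp⟩, by rintro ⟨w, hw, rfl⟩; simpa using hw⟩

/-- A ray in the piece would have a tail in `g C` or on the `Q`-side of `S`, and both are disjoint
from the piece. -/
theorem IsTranslation.isRayless_piece {R Q : Ray G} {g : G ≃g G} {S : Set V}
    (h : IsTranslation R Q g S) (hall : ∀ P : Ray G, P.Equivalent R ∨ P.Equivalent Q) :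
    IsRayless (G.induce (piece g S (live G S R))) := by
  refine ⟨fun P' => ?_⟩
  let P : Ray G :=
    ⟨fun n => (P'.vert n : V), Subtype.val_injective.comp P'.injective, fun n => P'.adj n⟩
  have hmem : ∀ n, P.vert n ∈ piece g S (live G S R) := fun n => (P'.vert n).2
  rcases hall P with hP | hP
  · have hfin := h.isSeparator.finite.image g
    obtain ⟨N, hN⟩ := eventually_mem_live hfin P
    have := hN N le_rfl
    rw [live_congr hfin hP] at this
    exact (hmem N).2 (h.inv_mem_live_iff.2 this)
  · have hfin := h.isSeparator.finite
    obtain ⟨N, hN⟩ := eventually_mem_live hfin P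
    have := hN N le_rfl
    rw [live_congr hfin hP] at this
    rcases (hmem N).1 with h1 | h1
    · exact notMem_of_mem_live this h1
    · exact Set.disjoint_left.1 h.isSeparator.disjoint h1 this

/-- Let `F` consist of `S`, `g S` and a path in the piece joining them. Each vertex of the piece is
within `r` of all points of a separator `k S`, which cannot lie inside the piece and avoid `F`. So a
walk of length at most `r` meets `F` or leaves the piece, and it must meet `F` before leaving. As
`F` is finite and the piece connected, the diameter is bounded. -/
theorem IsTranslation.ediam_piece_ne_top (hG : G.Connected) (hqt : IsQuasiTransitive G)
    {R Q : Ray G} {g : G ≃g G} {S : Set V} (h : IsTranslation R Q g S)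
    (hall : ∀ P : Ray G, P.Equivalent R ∨ P.Equivalent Q) :
    (G.induce (piece g S (live G S R))).ediam ≠ ⊤ := by
  have hsh := h.isShift hG
  set C := live G S R with hC
  have hconn := hsh.connected_piece hG
  have hSfin := h.isSeparator.finite
  obtain ⟨s₀, hs₀⟩ := h.isSeparator.nonempty
  obtain ⟨π, hπ⟩ := (hsh.sameComponent_compl_piece hG (hsh.mem_piece_of_mem hs₀)
    (hsh.mem_piece_of_inv_mem (s := g s₀) (by simpa using hs₀))).exists_walk
  let F : Set V := {x | x ∈ π.support} ∪ S ∪ g '' S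
  have hFfin : F.Finite := ((List.finite_toSet _).union hSfin).union (hSfin.image g)
  have hSF : S ⊆ F := fun x hx => Or.inl (Or.inr hx)
  have hgSF : ∀ v, g⁻¹ v ∈ S → v ∈ F := fun v hv => Or.inr ⟨_, hv, by simp⟩
  have hF : F ⊆ piece g S C := by
    rintro x ((hx | hx) | ⟨y, hy, rfl⟩)
    · simpa using hπ x hx
    · exact hsh.mem_piece_of_mem hx
    · exact hsh.mem_piece_of_inv_mem (by simpa using hy)
  obtain ⟨r, hr⟩ := exists_forall_exists_dist_le hG hqt hSfin
  have hnear : ∀ v : piece g S C, ∃ w : piece g S C, (w : V) ∈ F ∧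
      (G.induce (piece g S C)).dist v w ≤ r := by
    rintro ⟨v, hv⟩
    obtain ⟨k, hk⟩ := hr v
    have hsep : Disjoint (live G (k '' S) R) (live G (k '' S) Q) := by
      rcases fixesEnds_or_swapsEnds h.isSeparator.not_equivalent hall k with hf | hf
      · exact ((h.isSeparator.map k).congr hf.1 hf.2).disjoint
      · exact ((h.isSeparator.map k).congr hf.1 hf.2).disjoint.symm
    -- Otherwise `S` with its `Q`-side, the path `π`, and `g S` with its `R`-side all avoid `k S`,
    -- and together they connect the two ends that `k S` separates.
    have hmeet : ∃ z ∈ k '' S, z ∈ F ∨ z ∉ piece g S C := by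
      by_contra hcon
      push Not at hcon
      have h1 := IsSeparator.subset_live_of_disjoint (Q := Q) hG hSfin h.isSeparator.connected
        (B := k '' S) (Set.disjoint_left.2 fun z hz hzS => (hcon z hz).1 (hSF hzS))
        (Set.disjoint_left.2 fun z hz hzQ => by
          rcases (hcon z hz).2.1 with h1 | h1
          · exact notMem_of_mem_live hzQ h1
          · exact Set.disjoint_left.1 h.isSeparator.disjoint h1 hzQ)
      have h2 := IsSeparator.subset_live_of_disjoint (Q := R) hG (hSfin.image g)
        (connected_induce_image g h.isSeparator.connected)
        (B := k '' S) (Set.disjoint_left.2 fun z hz hzS => (hcon z hz).1 (Or.inr hzS))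
        (Set.disjoint_left.2 fun z hz hzR => (hcon z hz).2.2 (h.inv_mem_live_iff.2 hzR))
      have h3 : SameComponent G (k '' S) s₀ (g s₀) :=
        .of_walk π fun x hx hxk => (hcon x hxk).1 (Or.inl (Or.inl hx))
      exact Set.disjoint_left.1 hsep (h2.1 ⟨s₀, hs₀, rfl⟩)
        (live_of_sameComponent (h1.1 hs₀) h3)
    obtain ⟨_, ⟨s, hs, rfl⟩, hz⟩ := hmeet
    obtain ⟨p, hp⟩ := hG.exists_walk_length_eq_dist v (k s)
    obtain ⟨w, hw, q, hq⟩ := hsh.exists_walk_piece hF hSF hgSF p hv hz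
    exact ⟨⟨w, hF hw⟩, hw, (SimpleGraph.dist_le q).trans (hq.trans (hp.trans_le (hk s hs)))⟩
  have hFfin' : {w : piece g S C | (w : V) ∈ F}.Finite :=
    hFfin.preimage Subtype.val_injective.injOn
  obtain ⟨D, hD⟩ := ((hFfin'.prod hFfin').image
    fun p => (G.induce (piece g S C)).dist p.1 p.2).bddAbove
  have hle : (G.induce (piece g S C)).ediam ≤ ((r + D + r : ℕ) : ℕ∞) := by
    refine SimpleGraph.ediam_le_of_edist_le fun x y => ?_
    obtain ⟨w, hw, hxw⟩ := hnear x
    obtain ⟨w', hw', hyw⟩ := hnear y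
    have h1 : (G.induce (piece g S C)).dist w w' ≤ D := hD ⟨(w, w'), ⟨hw, hw'⟩, rfl⟩
    have h2 := hconn.dist_triangle (u := x) (v := w) (w := y)
    have h3 := hconn.dist_triangle (u := w) (v := w') (w := y)
    rw [SimpleGraph.dist_comm] at hyw
    rw [← (hconn x y).coe_dist_eq_edist]
    exact_mod_cast (by omega)
  exact ne_top_of_le_ne_top (ENat.natCast_ne_top _) hle

end Shift

theorem doubleRay_isTree : doubleRay.IsTree := by
  refine ⟨doubleRay_connected, SimpleGraph.isAcyclic_iff_forall_adj_isBridge.2 ?_⟩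
  have key : ∀ i : ℤ, doubleRay.IsBridge s(i, i + 1) := by
    intro i
    rw [SimpleGraph.isBridge_iff]
    rintro ⟨p⟩
    -- Only the deleted edge leads from `{n | n ≤ i}` to its complement.
    have : ∀ a b : ℤ, ∀ _ : (doubleRay.deleteEdges {s(i, i + 1)}).Walk a b, a ≤ i → b ≤ i := by
      intro a b p
      induction p with
      | nil => exact id
      | @cons a b c hab p ih =>
        intro ha
        refine ih ?_
        rw [SimpleGraph.deleteEdges_adj] at hab
        obtain ⟨hab | hab, hne⟩ := hab
        · rcases ha.lt_or_eq with h | rfl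
          · omega
          · exact absurd (by rw [hab]; rfl) hne
        · omega
    have := this _ _ p le_rfl
    omega
  rintro i j (rfl | rfl)
  · exact key i
  · rw [Sym2.eq_swap]
    exact key j

/-! ### The chain of copies of one graph over the double ray -/

section Chain

variable {U N : Type u} {Γ : SimpleGraph U} {H : SimpleGraph N}

/-- The tree-amalgamation over the double ray of copies of `Γ` in which the copy of `H` given by
`ι 1` in each factor is identified with the copy of `H` given by `ι 0` in the next factor. -/
noncomputable def chain (ι : Fin 2 → (H ↪g Γ)) :
    TreeAmalgamation Γ Γ doubleRay (Fin 2) (Fin 2) where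
  isTree := doubleRay_isTree
  side₁ := {n | Even n}
  bipartition := by
    rintro s t (rfl | rfl) <;> simp only [Set.mem_ofPred_eq, Int.even_add_one, not_not]
  -- The first coordinate belongs to the even endpoint. Whichever endpoint is even, adhesion `1` of
  -- the lower endpoint is thus glued to adhesion `0` of the upper one.
  label e := if Even e.1.inf then (1, 0) else (0, 1)
  label_bijective₁ := by
    intro s hs
    have hs' : Even s := hs
    have hs'' : ¬ Even (s - 1) := by simpa [Int.even_sub_one] using hs'
    constructor
    · rintro ⟨t, ht⟩ ⟨t', ht'⟩ h
      have e1 : t = s + 1 ∨ t = s - 1 := by rcases ht with h | h <;> omega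
      have e2 : t' = s + 1 ∨ t' = s - 1 := by rcases ht' with h | h <;> omega
      rcases e1 with rfl | rfl <;> rcases e2 with rfl | rfl
      · rfl
      · simp [hs', hs''] at h
      · simp [hs', hs''] at h
      · rfl
    · intro k
      fin_cases k
      · exact ⟨⟨s - 1, Or.inr (by ring)⟩, by simp [hs'']⟩
      · exact ⟨⟨s + 1, Or.inl rfl⟩, by simp [hs']⟩
  label_bijective₂ := by
    intro s hs
    have hs' : ¬ Even s := hs
    have hs'' : Even (s - 1) := by simpa [Int.even_sub_one] using hs'
    constructor
    · rintro ⟨t, ht⟩ ⟨t', ht'⟩ h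
      have e1 : t = s + 1 ∨ t = s - 1 := by rcases ht with h | h <;> omega
      have e2 : t' = s + 1 ∨ t' = s - 1 := by rcases ht' with h | h <;> omega
      rcases e1 with rfl | rfl <;> rcases e2 with rfl | rfl
      · rfl
      · simp [hs', hs''] at h
      · simp [hs', hs''] at h
      · rfl
    · intro k
      fin_cases k
      · exact ⟨⟨s - 1, Or.inr (by ring)⟩, by simp [hs'']⟩
      · exact ⟨⟨s + 1, Or.inl rfl⟩, by simp [hs']⟩
  adh₁ k := Set.range (ι k)
  adh₂ k := Set.range (ι k)
  φ k l := (Equiv.ofInjective _ (ι k).injective).symm.trans (Equiv.ofInjective _ (ι l).injective)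

variable (ι : Fin 2 → (H ↪g Γ))

theorem chain_φ_apply (k l : Fin 2) (n : N) (hn : ι k n ∈ (chain ι).adh₁ k) :
    ((chain ι).φ k l ⟨ι k n, hn⟩ : U) = ι l n := by
  have : (Equiv.ofInjective _ (ι k).injective).symm ⟨ι k n, hn⟩ = n :=
    Equiv.ofInjective_symm_apply (ι k).injective n
  show ((Equiv.ofInjective _ (ι l).injective)
    ((Equiv.ofInjective _ (ι k).injective).symm ⟨ι k n, hn⟩) : U) = ι l n
  rw [this]
  rfl

theorem chain_label (s t : ℤ) (h : doubleRay.Adj s t) :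
    (chain ι).label ⟨s(s, t), h⟩ = if Even (min s t) then (1, 0) else (0, 1) := rfl

theorem chain_identifyingMapsAreIdentity : (chain ι).IdentifyingMapsAreIdentity := by
  refine ⟨N, H, ι, fun _ => rfl, fun _ => rfl, ?_⟩
  rintro k l ⟨x, hx⟩ n hxn
  obtain rfl : x = ι k n := hxn
  exact chain_φ_apply ι k l n hx

/-- The vertex of `Γ` of which the given vertex is a copy. -/
def chainPoint : (chain ι).PreVertex → U := Sum.elim Prod.snd Prod.snd

variable {ι}

theorem exists_preVertex (n : ℤ) (x : U) :
    ∃ p : (chain ι).PreVertex, (chain ι).index p = n ∧ chainPoint ι p = x := by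
  by_cases hn : n ∈ (chain ι).side₁
  · exact ⟨Sum.inl (⟨n, hn⟩, x), rfl, rfl⟩
  · exact ⟨Sum.inr (⟨n, hn⟩, x), rfl, rfl⟩

theorem preVertex_ext {p q : (chain ι).PreVertex} (hi : (chain ι).index p = (chain ι).index q)
    (hx : chainPoint ι p = chainPoint ι q) : p = q := by
  rcases p with ⟨s, x⟩ | ⟨t, y⟩ <;> rcases q with ⟨s', x'⟩ | ⟨t', y'⟩
  · exact congrArg Sum.inl (Prod.ext (Subtype.ext hi) hx)
  · have h' : (s : ℤ) = t' := hi
    exact absurd (h' ▸ s.2) t'.2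
  · have h' : (t : ℤ) = s' := hi
    exact absurd (h' ▸ s'.2) t.2
  · exact congrArg Sum.inr (Prod.ext (Subtype.ext hi) hx)

theorem chain_preAdj_iff {p q : (chain ι).PreVertex} : (chain ι).PreAdj p q ↔
    (chain ι).index p = (chain ι).index q ∧ Γ.Adj (chainPoint ι p) (chainPoint ι q) := by
  rcases p with ⟨s, x⟩ | ⟨t, y⟩ <;> rcases q with ⟨s', x'⟩ | ⟨t', y'⟩
  · exact and_congr_left fun _ => Subtype.ext_iff
  · refine ⟨False.elim, fun ⟨h, _⟩ => ?_⟩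
    have h' : (s : ℤ) = t' := h
    exact absurd (h' ▸ s.2) t'.2
  · refine ⟨False.elim, fun ⟨h, _⟩ => ?_⟩
    have h' : (t : ℤ) = s' := h
    exact absurd (h' ▸ s'.2) t.2
  · exact and_congr_left fun _ => Subtype.ext_iff

/-- With `exists_of_chain_glue`, this describes gluing by index and point alone, so that parity
plays no role afterwards. -/
theorem toVertex_eq_of_index_add_one {p q : (chain ι).PreVertex} (n : N)
    (hi : (chain ι).index q = (chain ι).index p + 1) (hp : chainPoint ι p = ι 1 n)
    (hq : chainPoint ι q = ι 0 n) : (chain ι).toVertex p = (chain ι).toVertex q := by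
  rcases p with ⟨s, x⟩ | ⟨t, y⟩ <;> rcases q with ⟨s', x'⟩ | ⟨t', y'⟩
  · have h' : (s' : ℤ) = s + 1 := hi
    have h1 : Even (s' : ℤ) := s'.2
    have h2 : Even (s : ℤ) := s.2
    rw [h', Int.even_add_one] at h1
    exact absurd h2 h1
  · have h' : (t' : ℤ) = s + 1 := hi
    obtain rfl : x = ι 1 n := hp
    obtain rfl : y' = ι 0 n := hq
    have hadj : doubleRay.Adj s t' := Or.inl h'
    have hlab : (chain ι).label ⟨s((s : ℤ), (t' : ℤ)), hadj⟩ = (1, 0) := by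
      have h2 : Even (s : ℤ) := s.2
      rw [chain_label, if_pos]
      rwa [h', min_eq_left (by omega)]
    have key : ∀ kl : Fin 2 × Fin 2, kl = (1, 0) → ∃ hx : ι 1 n ∈ (chain ι).adh₁ kl.1,
        ((chain ι).φ kl.1 kl.2 ⟨ι 1 n, hx⟩ : U) = ι 0 n := by
      rintro _ rfl
      exact ⟨⟨n, rfl⟩, chain_φ_apply ι 1 0 n _⟩
    exact Quot.sound ⟨hadj, key _ hlab⟩
  · have h' : (s' : ℤ) = t + 1 := hi
    obtain rfl : y = ι 1 n := hp
    obtain rfl : x' = ι 0 n := hq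
    have hadj : doubleRay.Adj s' t := Or.inr h'
    have hlab : (chain ι).label ⟨s((s' : ℤ), (t : ℤ)), hadj⟩ = (0, 1) := by
      have h2 : ¬ Even (t : ℤ) := t.2
      rw [chain_label, if_neg]
      rwa [h', min_eq_right (by omega)]
    have key : ∀ kl : Fin 2 × Fin 2, kl = (0, 1) → ∃ hx : ι 0 n ∈ (chain ι).adh₁ kl.1,
        ((chain ι).φ kl.1 kl.2 ⟨ι 0 n, hx⟩ : U) = ι 1 n := by
      rintro _ rfl
      exact ⟨⟨n, rfl⟩, chain_φ_apply ι 0 1 n _⟩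
    exact (Quot.sound ⟨hadj, key _ hlab⟩).symm
  · have h' : (t' : ℤ) = t + 1 := hi
    have h1 : ¬ Even (t' : ℤ) := t'.2
    have h2 : ¬ Even (t : ℤ) := t.2
    rw [h', Int.even_add_one] at h1
    exact absurd h2 h1

theorem exists_of_chain_glue {p q : (chain ι).PreVertex} (h : (chain ι).Glue p q) : ∃ n : N,
    ((chain ι).index q = (chain ι).index p + 1 ∧ chainPoint ι p = ι 1 n ∧ chainPoint ι q = ι 0 n) ∨
    ((chain ι).index p = (chain ι).index q + 1 ∧ chainPoint ι q = ι 1 n ∧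
      chainPoint ι p = ι 0 n) := by
  rcases p with ⟨s, x⟩ | ⟨t, y⟩ <;> rcases q with ⟨s', x'⟩ | ⟨t', y'⟩
  · exact h.elim
  · obtain ⟨hadj, hglue⟩ := h
    have h2 : Even (s : ℤ) := s.2
    have key : ∀ k l : Fin 2, (chain ι).label ⟨s((s : ℤ), (t' : ℤ)), hadj⟩ = (k, l) →
        ∃ n, x = ι k n ∧ y' = ι l n := by
      intro k l hkl
      rw [hkl] at hglue
      obtain ⟨⟨n, rfl⟩, rfl⟩ := hglue
      exact ⟨n, rfl, chain_φ_apply ι k l n _⟩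
    have hlab := chain_label ι s t' hadj
    rcases hadj with h' | h'
    · rw [min_eq_left (by omega), if_pos h2] at hlab
      obtain ⟨n, hx, hy⟩ := key 1 0 hlab
      exact ⟨n, Or.inl ⟨h', hx, hy⟩⟩
    · have h3 : ¬ Even (t' : ℤ) := t'.2
      rw [min_eq_right (by omega), if_neg h3] at hlab
      obtain ⟨n, hx, hy⟩ := key 0 1 hlab
      exact ⟨n, Or.inr ⟨h', hy, hx⟩⟩
  · exact h.elim
  · exact h.elim

end Chain

/-! ### Tiling the graph by translates of the piece -/

section Layers

variable {V : Type u} {G : SimpleGraph V} {g : G ≃g G} {S C : Set V}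

theorem zpow_neg_add_one_apply (g : G ≃g G) (n : ℤ) (v : V) :
    (g ^ (-(n + 1))) v = g⁻¹ ((g ^ (-n)) v) := by
  rw [neg_add_rev, zpow_add, zpow_neg_one]
  rfl

namespace IsShift

theorem mem_of_mem_add_one (h : IsShift g S C) {n : ℤ} {v : V}
    (hv : (g ^ (-(n + 1))) v ∈ S ∪ C) : (g ^ (-n)) v ∈ C := by
  rw [zpow_neg_add_one_apply] at hv
  exact h.mem_of_inv_mem hv

theorem mem_of_le (h : IsShift g S C) {m n : ℤ} (hmn : m ≤ n) {v : V}
    (hv : (g ^ (-n)) v ∈ S ∪ C) : (g ^ (-m)) v ∈ S ∪ C := by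
  induction n, hmn using Int.leInduction with
  | base => exact hv
  | succ n hn ih => exact ih (Or.inr (h.mem_of_mem_add_one hv))

theorem mem_of_adj (h : IsShift g S C) {n : ℤ} {v w : V} (hvw : G.Adj v w)
    (hv : (g ^ (-(n + 1))) v ∈ S ∪ C) : (g ^ (-n)) w ∈ S ∪ C :=
  h.closed _ (h.mem_of_mem_add_one hv) _ ((g ^ (-n) : G ≃g G).map_adj_iff.2 hvw)

/-- The translates `g ^ n (S ∪ C)` decrease in `n`, and crossing one edge lowers the attained level
by at most one. -/
theorem mem_of_walk (h : IsShift g S C) {v w : V} (p : G.Walk v w) (n : ℤ)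
    (hv : (g ^ (-n)) v ∈ S ∪ C) : (g ^ (-(n - p.length))) w ∈ S ∪ C := by
  induction p generalizing n with
  | nil => simpa using hv
  | @cons a b c hab p ih =>
    have h1 := ih (n - 1) (h.mem_of_adj hab (by simpa using hv))
    rw [SimpleGraph.Walk.length_cons,
      show n - ((p.length + 1 : ℕ) : ℤ) = n - 1 - p.length by push_cast; ring]
    exact h1

/-- Every vertex lies in a last set of the decreasing sequence of translates. -/
theorem exists_bounds (h : IsShift g S C) (hG : G.Connected) (v : V) :
    ∃ k : ℤ, (g ^ (-(-k))) v ∈ S ∪ C ∧ ∀ n, (g ^ (-n)) v ∈ S ∪ C → n ≤ k := by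
  obtain ⟨s, hs⟩ := Set.nonempty_coe_sort.1 h.connected.nonempty
  obtain ⟨p⟩ := hG s v
  refine ⟨p.length, ?_, fun n hn => ?_⟩
  · have := h.mem_of_walk p 0 (Or.inl (by simpa using hs))
    simpa using this
  · by_contra hlt
    push Not at hlt
    have h1 := h.mem_of_walk p.reverse n hn
    rw [SimpleGraph.Walk.length_reverse] at h1
    have h2 := h.mem_of_le (m := 0 + 1) (by omega) h1
    have h3 := h.mem_of_mem_add_one h2
    exact h.notMem s hs (by simpa using h3)

/-- Take the largest `n` such that `g ^ n (S ∪ C)` contains both vertices. If one of them lay in `g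
^ (n + 1) C`, the other would lie in `g ^ (n + 1) (S ∪ C)`, against maximality. The case `v = w`
shows that the layers cover all vertices. -/
theorem exists_layer_of_adj_or_eq (h : IsShift g S C) (hG : G.Connected) {v w : V}
    (hvw : v = w ∨ G.Adj v w) :
    ∃ n : ℤ, (g ^ (-n)) v ∈ piece g S C ∧ (g ^ (-n)) w ∈ piece g S C := by
  obtain ⟨k, hk, hk'⟩ := h.exists_bounds hG v
  obtain ⟨l, hl, hl'⟩ := h.exists_bounds hG w
  obtain ⟨n, ⟨hnv, hnw⟩, hmax⟩ := Int.exists_greatest_of_bdd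
    (P := fun n => (g ^ (-n)) v ∈ S ∪ C ∧ (g ^ (-n)) w ∈ S ∪ C)
    ⟨k, fun z hz => hk' z hz.1⟩
    ⟨min (-k) (-l), h.mem_of_le (min_le_left _ _) hk, h.mem_of_le (min_le_right _ _) hl⟩
  refine ⟨n, ⟨hnv, fun hv => ?_⟩, ⟨hnw, fun hw => ?_⟩⟩
  · rw [← zpow_neg_add_one_apply] at hv
    have hw : (g ^ (-(n + 1))) w ∈ S ∪ C := by
      rcases hvw with rfl | hvw
      · exact Or.inr hv
      · exact h.closed _ hv _ ((g ^ (-(n + 1)) : G ≃g G).map_adj_iff.2 hvw)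
    have := hmax (n + 1) ⟨Or.inr hv, hw⟩
    omega
  · rw [← zpow_neg_add_one_apply] at hw
    have hv : (g ^ (-(n + 1))) v ∈ S ∪ C := by
      rcases hvw with rfl | hvw
      · exact Or.inr hw
      · exact h.closed _ hw _ ((g ^ (-(n + 1)) : G ≃g G).map_adj_iff.2 hvw.symm)
    have := hmax (n + 1) ⟨hv, Or.inr hw⟩
    omega

/-- Different translates of the piece only meet if they are consecutive, and then in a translate
of `S`. -/
theorem layers_inter (h : IsShift g S C) {m n : ℤ} (hmn : m < n) {v : V}
    (hm : (g ^ (-m)) v ∈ piece g S C) (hn : (g ^ (-n)) v ∈ piece g S C) :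
    n = m + 1 ∧ (g ^ (-n)) v ∈ S := by
  have h1 : (g ^ (-(m + 1))) v ∉ C := by rw [zpow_neg_add_one_apply]; exact hm.2
  obtain rfl : n = m + 1 := by
    by_contra hne
    exact h1 (h.mem_of_mem_add_one (h.mem_of_le (n := n) (by omega) hn.1))
  exact ⟨rfl, hn.1.resolve_right h1⟩

/-- The two embeddings of the graph on `S` into the piece. -/
def embedding (h : IsShift g S C) : Fin 2 → (G.induce S ↪g G.induce (piece g S C))
  | 0 =>
    { toFun := fun s => ⟨s, h.mem_piece_of_mem s.2⟩
      inj' := fun s t hst => by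
        have hst' := Subtype.ext_iff.1 hst
        exact Subtype.ext hst'
      map_rel_iff' := Iff.rfl }
  | 1 =>
    { toFun := fun s => ⟨g s, h.mem_piece_of_inv_mem (by simp)⟩
      inj' := fun s t hst => by
        have hst' := Subtype.ext_iff.1 hst
        exact Subtype.ext (g.injective hst')
      map_rel_iff' := g.map_adj_iff }

theorem embedding_zero (h : IsShift g S C) (s : S) : (h.embedding 0 s : V) = s := rfl

theorem embedding_one (h : IsShift g S C) (s : S) : (h.embedding 1 s : V) = g s := rfl

/-- The vertex of the graph represented by a vertex of a copy of the piece. -/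
noncomputable def chainMap (h : IsShift g S C) (p : (chain h.embedding).PreVertex) : V :=
  (g ^ (chain h.embedding).index p) (chainPoint h.embedding p).1

theorem chainPoint_eq (h : IsShift g S C) (p : (chain h.embedding).PreVertex) :
    (chainPoint h.embedding p).1 = (g ^ (-(chain h.embedding).index p)) (h.chainMap p) := by
  rw [chainMap, zpow_neg, RelIso.inv_apply_self]

theorem chainMap_eq_of_index_add_one (h : IsShift g S C) {p q : (chain h.embedding).PreVertex}
    {s : S} (hi : (chain h.embedding).index q = (chain h.embedding).index p + 1)
    (hp : chainPoint h.embedding p = h.embedding 1 s)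
    (hq : chainPoint h.embedding q = h.embedding 0 s) :
    h.chainMap p = h.chainMap q := by
  rw [chainMap, chainMap, hp, hq, hi, embedding_zero, embedding_one, zpow_add_one]
  rfl

theorem chainMap_eq_of_glue (h : IsShift g S C) {p q : (chain h.embedding).PreVertex}
    (hpq : (chain h.embedding).Glue p q) : h.chainMap p = h.chainMap q := by
  obtain ⟨s, ⟨hi, hp, hq⟩ | ⟨hi, hp, hq⟩⟩ := exists_of_chain_glue hpq
  · exact h.chainMap_eq_of_index_add_one hi hp hq
  · exact (h.chainMap_eq_of_index_add_one hi hp hq).symm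

/-- Injectivity of the comparison map: different layers overlap only when consecutive and then in a
translate of `S`, which is precisely what the chain identifies. -/
theorem toVertex_eq_of_chainMap_eq (h : IsShift g S C) {p q : (chain h.embedding).PreVertex}
    (hpq : h.chainMap p = h.chainMap q) :
    (chain h.embedding).toVertex p = (chain h.embedding).toVertex q := by
  have key : ∀ p q : (chain h.embedding).PreVertex, h.chainMap p = h.chainMap q →
      (chain h.embedding).index p < (chain h.embedding).index q →
      (chain h.embedding).toVertex p = (chain h.embedding).toVertex q := by
    intro p q hpq hlt
    have hp := h.chainPoint_eq p
    have hq := h.chainPoint_eq q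
    rw [← hpq] at hq
    obtain ⟨hi, hS⟩ := h.layers_inter hlt (hp ▸ (chainPoint h.embedding p).2)
      (hq ▸ (chainPoint h.embedding q).2)
    refine toVertex_eq_of_index_add_one ⟨_, hS⟩ hi (Subtype.ext ?_) (Subtype.ext ?_)
    · rw [embedding_one, hp]
      change _ = g ((g ^ (-(chain h.embedding).index q)) (h.chainMap p))
      rw [hi, zpow_neg_add_one_apply, RelIso.apply_inv_self]
    · rw [embedding_zero, hq]
  rcases lt_trichotomy ((chain h.embedding).index p) ((chain h.embedding).index q) with hi | hi | hi
  · exact key p q hpq hi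
  · refine congrArg _ (preVertex_ext hi (Subtype.ext ?_))
    rw [chainPoint_eq, chainPoint_eq, hpq, hi]
  · exact (key q p hpq.symm hi).symm

theorem exists_chainMap_eq (h : IsShift g S C) {n : ℤ} {v : V}
    (hv : (g ^ (-n)) v ∈ piece g S C) : ∃ p : (chain h.embedding).PreVertex,
      (chain h.embedding).index p = n ∧ (chainPoint h.embedding p).1 = (g ^ (-n)) v ∧
        h.chainMap p = v := by
  obtain ⟨p, hp, hpx⟩ := exists_preVertex (ι := h.embedding) n ⟨_, hv⟩
  have hpv : (chainPoint h.embedding p).1 = (g ^ (-n)) v := congrArg Subtype.val hpx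
  refine ⟨p, hp, hpv, ?_⟩
  rw [chainMap, hp, hpv, zpow_neg, RelIso.apply_inv_self]

/-- The graph is the tree-amalgamation of the translates of the piece. -/
theorem nonempty_iso_chain (h : IsShift g S C) (hG : G.Connected) :
    Nonempty (G ≃g (chain h.embedding).graph) := by
  let Φ : (chain h.embedding).Vertex → V :=
    Quot.lift h.chainMap fun _ _ hpq => h.chainMap_eq_of_glue hpq
  have hΦ : ∀ p, Φ ((chain h.embedding).toVertex p) = h.chainMap p := fun _ => rfl
  have hrep : ∀ a, ∃ p, (chain h.embedding).toVertex p = a := fun a => Quot.exists_rep a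
  have hinj : Function.Injective Φ := by
    intro a b hab
    obtain ⟨p, rfl⟩ := hrep a
    obtain ⟨q, rfl⟩ := hrep b
    exact h.toVertex_eq_of_chainMap_eq hab
  have hsurj : Function.Surjective Φ := by
    intro v
    obtain ⟨n, hn, -⟩ := h.exists_layer_of_adj_or_eq hG (Or.inl (rfl : v = v))
    obtain ⟨p, -, -, hp⟩ := h.exists_chainMap_eq hn
    exact ⟨(chain h.embedding).toVertex p, hp⟩
  refine ⟨RelIso.symm ⟨Equiv.ofBijective Φ ⟨hinj, hsurj⟩, ?_⟩⟩
  intro a b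
  show G.Adj (Φ a) (Φ b) ↔ (chain h.embedding).graph.Adj a b
  constructor
  · intro hab
    obtain ⟨n, hna, hnb⟩ := h.exists_layer_of_adj_or_eq hG (Or.inr hab)
    obtain ⟨p, hpi, hpx, hp⟩ := h.exists_chainMap_eq hna
    obtain ⟨q, hqi, hqx, hq⟩ := h.exists_chainMap_eq hnb
    refine ⟨fun he => hab.ne (congrArg Φ he), p, q, chain_preAdj_iff.2 ⟨hpi.trans hqi.symm, ?_⟩,
      hinj hp, hinj hq⟩
    rw [SimpleGraph.induce_adj, hpx, hqx]
    exact (g ^ (-n) : G ≃g G).map_adj_iff.2 hab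
  · rintro ⟨-, p, q, hpq, rfl, rfl⟩
    obtain ⟨hi, hadj⟩ := chain_preAdj_iff.1 hpq
    show G.Adj (h.chainMap p) (h.chainMap q)
    rw [chainMap, chainMap, hi]
    exact RelIso.map_rel_iff _ |>.2 hadj

end IsShift

end Layers

/-! ### Assembling the equivalence -/

theorem splitsAsStronglyThin_of_isTwoEnded {V : Type u} {G : SimpleGraph V} (hG : G.Connected)
    (hqt : IsQuasiTransitive G) (hdom : NoDominatedEnd G) (h : IsTwoEnded G) :
    SplitsAsStronglyThin G := by
  obtain ⟨R, Q, hRQ, hall⟩ := isTwoEnded_iff.1 h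
  obtain ⟨g, S, ht⟩ := exists_isTranslation hG hqt hdom hRQ hall
  have hs := ht.isShift hG
  have hray := ht.isRayless_piece hall
  have : Finite S := hs.finite
  have hadh : ∀ k, (Set.range (hs.embedding k)).Finite := fun k => Set.finite_range _
  -- The adhesions are `S` and `g S`; the latter lies in `C`, which misses `S`.
  have hdisj : Disjoint (Set.range (hs.embedding 0)) (Set.range (hs.embedding 1)) := by
    rw [Set.disjoint_left]
    rintro _ ⟨s, rfl⟩ ⟨t, hst⟩
    have h1 : g t = (s : V) := congrArg Subtype.val hst
    exact hs.notMem s s.2 (h1 ▸ hs.map_mem t (Or.inl t.2))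
  refine ⟨_, _, chain hs.embedding, hs.nonempty_iso_chain hG,
    ⟨⟨⟨RelIso.refl _⟩, hadh, hadh⟩, hray, hray⟩,
    ⟨hs.connected_piece hG, hray, ht.ediam_piece_ne_top hG hqt hall⟩,
    chain_identifyingMapsAreIdentity _, fun k => ⟨hadh k, ?_⟩, ?_⟩
  · have e : (G.induce S) ≃g (G.induce (piece g S (live G S R))).induce
        (Set.range (hs.embedding k)) :=
      ⟨Equiv.ofInjective _ (hs.embedding k).injective, (hs.embedding k).map_adj_iff⟩
    exact e.connected_iff.1 hs.connected
  · intro k l hkl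
    fin_cases k <;> fin_cases l
    exacts [absurd rfl hkl, hdisj, hdisj.symm, absurd rfl hkl]

end TwoEndedGraph

theorem mainTheorem1 {V : Type*} (G : SimpleGraph V) (hconn : G.Connected)
    (hqt : TwoEndedGraph.IsQuasiTransitive G) (hdom : TwoEndedGraph.NoDominatedEnd G) :
    List.TFAE [TwoEndedGraph.IsTwoEnded G,
      TwoEndedGraph.SplitsAsStronglyThin G,
      TwoEndedGraph.QuasiIsometric G TwoEndedGraph.doubleRay] := by
  tfae_have 1 → 2 := TwoEndedGraph.splitsAsStronglyThin_of_isTwoEnded hconn hqt hdom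
  tfae_have 2 → 3 := TwoEndedGraph.quasiIsometric_of_splits hconn
  tfae_have 3 → 1 := TwoEndedGraph.isTwoEnded_of_quasiIsometric hconn hdom
  tfae_finish
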